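/- Consider the fifth-order KdV-BBM equation for a real-valued function $\eta=\eta(x,t)$, $x\in\mathbb R$, \[ \partial_t \eta +\partial_x \eta -\gamma_1 \partial_t \partial_x^2 \eta + \gamma_2\partial_x^3 \eta+ \delta_1 \partial_t \partial_x^4 \eta+ \delta_2 \partial_x^5 \eta = - \tfrac 34 \partial_x (\eta^2)- \gamma\, \partial^3_x (\eta^2) + \tfrac 7{48} \partial_x (\eta_x^2)+ \tfrac18 \partial_x (\eta^3), \qquad \eta(x,0)=\eta_0(x), \] with real parameters $\gamma_1,\gamma_2,\delta_1,\delta_2,\gamma$ such that $\gamma_1,\delta_1>0$ and $\gamma=7/48$. For $\sigma\ge 0$ and $s\ge 0$ let $G^{\sigma,s}(\mathbb R)$ be the Gevrey space of all $f\in L^2(\mathbb R)$ with \[ \|f\|_{G^{\sigma,s}}=\big\|e^{\sigma|D_x|}\langle D_x\rangle^s f\big\|_{L^2_x}<\infty,\qquad D_x=-i\partial_x,\quad \langle\cdot\rangle=\sqrt{1+|\cdot|^2}, \] so that $G^{0,s}=H^s(\mathbb R)$. Let $\sigma_0>0$, let $\eta_0\in G^{\sigma_0,2}(\mathbb R)$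 be real-valued, and let $\eta\in C([0,\infty);H^2(\mathbb R))$ be the global solution of this Cauchy problem, where the equation is understood in the sense of distributions. Then there is a function $\sigma:(0,\infty)\to(0,\infty)$ such that \[ \eta(t)\in G^{\sigma(t),2}(\mathbb R)\quad\text{for all } t>0, \] and \[ \sigma(t)\ge \frac ct\quad\text{for all sufficiently large } t, \] where $c>0$ is a constant that depends only on $\|\eta_0\|_{G^{\sigma_0,2}}$ and on the parameters of the equation. -/

import Mathlib

open MeasureTheory Filter Set
open scoped Topology ENNReal FourierTransform SchwartzMap

noncomputable section

namespace KdVBBM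

/-- The space `L²(ℝ; ℝ)` of real-valued square-integrable functions on the line. -/
abbrev L2 : Type := Lp ℝ 2 (volume : Measure ℝ)

/-- The `L²` (Plancherel) Fourier transform `ξ ↦ ∫ exp (-2π i x ξ) f x dx` of a real-valued
`L²` function, regarded as an element of `L²(ℝ; ℂ)`. -/
def fourierL2 (f : L2) : Lp ℂ 2 (volume : Measure ℝ) :=
  𝓕 (Complex.ofRealCLM.compLp f : Lp ℂ 2 (volume : Measure ℝ))

/-- The Gevrey norm `‖exp (σ |D|) ⟨D⟩ ^ s f‖_{L²}`, with values in `[0, ∞]`, where `D = -i ∂ₓ` and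
`⟨D⟩ = (1 + D ^ 2) ^ (1 / 2)`. With the above normalization of the Fourier transform, `D` acts as
multiplication by `2 π ξ` on the Fourier side, and the norm is computed there by Plancherel.
For `σ = 0` this is the norm of the Sobolev space `H ^ s(ℝ)`. -/
def gevreyENorm (σ s : ℝ) (f : L2) : ℝ≥0∞ :=
  eLpNorm (fun ξ : ℝ ↦ ((Real.exp (σ * |2 * Real.pi * ξ|) *
    (1 + (2 * Real.pi * ξ) ^ 2) ^ (s / 2) : ℝ) : ℂ) * fourierL2 f ξ) 2 volume

/-- Membership in the Gevrey space `G ^ {σ, s}(ℝ)`, for real-valued functions. If `σ > 0`, or if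
`σ = 0` and `s ≥ 0`, then all elements of `G ^ {σ, s}(ℝ)` lie in `L²(ℝ)`, so nothing is lost by
taking `f` there; for `σ = 0` this is membership in `H ^ s(ℝ)`. -/
def MemGevrey (σ s : ℝ) (f : L2) : Prop :=
  gevreyENorm σ s f < ∞

/-- The Gevrey norm as a real number (meaningful on members of the Gevrey space). -/
def gevreyNorm (σ s : ℝ) (f : L2) : ℝ :=
  (gevreyENorm σ s f).toReal

/-- `g ∈ L²` is the distributional derivative of `f ∈ L²`. -/
def HasWeakDeriv (f g : L2) : Prop :=
  ∀ φ : 𝓢(ℝ, ℝ), ∫ x, f x * deriv φ x = -∫ x, g x * φ x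

/-- `η : [0, ∞) → H²(ℝ)` is a global solution, with initial datum `η₀`, of the fifth-order
KdV-BBM equation
```
∂ₜη + ∂ₓη - γ₁ ∂ₜ∂ₓ²η + γ₂ ∂ₓ³η + δ₁ ∂ₜ∂ₓ⁴η + δ₂ ∂ₓ⁵η
  = - 3/4 ∂ₓ(η²) - γ ∂ₓ³(η²) + 7/48 ∂ₓ(ηₓ²) + 1/8 ∂ₓ(η³).
```
It is continuous in time with values in `H²(ℝ)`, and the equation holds at each time `t ≥ 0` in
the sense of (tempered) distributions in `x`: all `x`-derivatives are moved to the test function,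
except the one inside `ηₓ²`. (Values of `η` at negative times play no role.) -/
structure IsGlobalSolution (γ₁ γ₂ δ₁ δ₂ γ : ℝ) (η₀ : L2) (η : ℝ → L2) : Prop where
  mem_sobolev : ∀ t : ℝ, 0 ≤ t → MemGevrey 0 2 (η t)
  continuous : ∀ t₀ : ℝ, 0 ≤ t₀ →
    Tendsto (fun t ↦ gevreyENorm 0 2 (η t - η t₀)) (𝓝[Ici 0] t₀) (𝓝 0)
  initial : η 0 = η₀
  equation : ∃ ηx : ℝ → L2, (∀ t : ℝ, 0 ≤ t → HasWeakDeriv (η t) (ηx t)) ∧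
    ∀ φ : 𝓢(ℝ, ℝ), ∀ t : ℝ, 0 ≤ t →
      HasDerivWithinAt
        (fun τ ↦ ∫ x, η τ x * (φ x - γ₁ * iteratedDeriv 2 φ x + δ₁ * iteratedDeriv 4 φ x))
        ((∫ x, η t x * (deriv φ x + γ₂ * iteratedDeriv 3 φ x + δ₂ * iteratedDeriv 5 φ x))
          + 3 / 4 * (∫ x, (η t x) ^ 2 * deriv φ x)
          + γ * (∫ x, (η t x) ^ 2 * iteratedDeriv 3 φ x)
          - 7 / 48 * (∫ x, (ηx t x) ^ 2 * deriv φ x)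
          - 1 / 8 * (∫ x, (η t x) ^ 3 * deriv φ x))
        (Ici 0) t

end KdVBBM

end

/-! On the Fourier side, with κ the angular frequency, let E(f) = ∫ (1 + γ₁κ² + δ₁κ⁴)|f|², which is
comparable to the squared H² norm. The linear terms do not change E, because their symbol is
imaginary. The quadratic terms contribute the integral of x(3/4 - 7/48 x² + 7/48 yz) against f f f
over the plane x + y + z = 0 of frequencies; the cubic term contributes the integral of x against f
f f f over x + y + z + u = 0. Averaging over cyclic permutations kills both: Σx = 0, while Σx³ =
3xyz cancels Σx·yz exactly because γ equals the coefficient 7/48 of ∂ₓ(ηₓ²). Hence E is conserved.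

Now insert the weight w = exp(σ min(|κ|, N)), bounded so that all quantities are finite for an H²
solution, and put v = wf. The flux of the weighted energy carries w(x)² f f f, whereas w(x)w(y)w(z)
f f f = v v v integrates to zero by the same cancellation. Only the commutator w(x) - w(y)w(z)
survives, and it is at most 2σ min(|y|,|z|) w(y)w(z); the quartic term is similar. The extra
frequency factor is affordable in H², so the flux is at most σ P(‖v‖) with P a polynomial
independent of σ and N (`energyFlux_estimate`). An energy that starts below M thus stays below 2M up
to time T when σT is small (`le_two_mul_of_growth`), which allows σ = c/T. Fatou's lemma removes N
(`memGevrey_of_weightedNorm_le`).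

The solution is only distributional, so the energy identity needs proof. Restricted to |ξ| < R the
equation becomes an integrated evolution equation in L² with continuous right-hand side
(`integral_momentumDeriv`). The identity holds there (`truncated_energy_identity`) and passes to the
limit R → ∞ by dominated convergence (`IsGlobalSolution.weightedEnergy_eq`). -/

noncomputable section

namespace KdVBBM

/-! ### Young-type integrability and cyclic changes of variables -/

section Multilinear

/-- The `L²` norm of a function on the line as a real number. -/
def l2norm {E : Type*} [NormedAddCommGroup E] (f : ℝ → E) : ℝ := (eLpNorm f 2 volume).toReal

theorem l2norm_nonneg {E : Type*} [NormedAddCommGroup E] (f : ℝ → E) : 0 ≤ l2norm f :=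
  ENNReal.toReal_nonneg

theorem measurePreserving_neg_add (c : ℝ) :
    MeasurePreserving (fun a : ℝ ↦ -(a + c)) volume volume :=
  (Measure.measurePreserving_neg volume).comp (measurePreserving_add_right volume c)

theorem l2norm_comp_neg_add {E : Type*} [NormedAddCommGroup E] {f : ℝ → E}
    (hf : AEStronglyMeasurable f volume) (c : ℝ) : l2norm (fun a ↦ f (-(a + c))) = l2norm f := by
  unfold l2norm
  rw [← eLpNorm_comp_measurePreserving hf (measurePreserving_neg_add c)]
  rfl

theorem memLp_comp_neg_add {E : Type*} [NormedAddCommGroup E] {f : ℝ → E}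
    (hf : MemLp f 2 volume) (c : ℝ) : MemLp (fun a ↦ f (-(a + c))) 2 volume :=
  hf.comp_measurePreserving (measurePreserving_neg_add c)

theorem integral_norm_mul_le {𝕜 : Type*} [RCLike 𝕜] {f g : ℝ → 𝕜} (hf : MemLp f 2 volume)
    (hg : MemLp g 2 volume) : ∫ x, ‖f x * g x‖ ≤ l2norm f * l2norm g := by
  have h := eLpNorm_le_eLpNorm_mul_eLpNorm_of_nnnorm (p := 2) (q := 2) (r := 1) hf.1 hg.1
    (fun a b ↦ a * b) 1 (ae_of_all _ fun x ↦ by simp)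
  rw [eLpNorm_one_eq_lintegral_enorm] at h
  have hm : AEStronglyMeasurable (fun x ↦ f x * g x) volume := hf.1.mul hg.1
  rw [integral_norm_eq_lintegral_enorm hm, l2norm, l2norm, ← ENNReal.toReal_mul]
  refine ENNReal.toReal_mono (ENNReal.mul_ne_top hf.2.ne hg.2.ne) ?_
  simpa using h

/-- A skew product of the identity with a reflected translation on each fibre. Both cyclic
permutations of the frequency hyperplanes below are built from it. -/
theorem measurePreserving_shear {Z : Type*} [MeasurableSpace Z] (ν : Measure Z) [SFinite ν]
    {ℓ : Z → ℝ} (hℓ : Measurable ℓ) :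
    MeasurePreserving (fun x : Z × ℝ ↦ (x.1, -(x.2 + ℓ x.1))) (ν.prod volume)
      (ν.prod volume) :=
  (MeasurePreserving.id ν).skew_product (g := fun z a ↦ -(a + ℓ z)) (by fun_prop)
    (ae_of_all _ fun z ↦ (measurePreserving_neg_add (ℓ z)).map_eq)

/-- Integrability of `p(z) q(a) r(-(a + ℓ(z)))` for `p ∈ L¹` and `q, r ∈ L²`. -/
theorem integrable_young {Z : Type*} [MeasurableSpace Z] {ν : Measure Z} [SFinite ν]
    {ℓ : Z → ℝ} (hℓ : Measurable ℓ) {p : Z → ℝ} (hp : Integrable p ν) {q r : ℝ → ℝ}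
    (hq : MemLp q 2 volume) (hr : MemLp r 2 volume) (hrm : Measurable r) :
    Integrable (fun x : Z × ℝ ↦ p x.1 * (q x.2 * r (-(x.2 + ℓ x.1)))) (ν.prod volume) ∧
    ∫ x : Z × ℝ, ‖p x.1 * (q x.2 * r (-(x.2 + ℓ x.1)))‖ ∂(ν.prod volume) ≤
      (∫ z, ‖p z‖ ∂ν) * (l2norm q * l2norm r) := by
  have hm : AEStronglyMeasurable (fun x : Z × ℝ ↦ p x.1 * (q x.2 * r (-(x.2 + ℓ x.1))))
      (ν.prod volume) := by
    refine hp.1.comp_fst.mul (hq.1.comp_snd.mul ?_)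
    exact (hrm.comp (by fun_prop)).aestronglyMeasurable
  -- Cauchy–Schwarz on each fibre; the reflected translate of `r` has the norm of `r`, so the bound
  -- does not see `ℓ z`.
  have hb (z : Z) : ∫ a, ‖p z * (q a * r (-(a + ℓ z)))‖ ≤ ‖p z‖ * (l2norm q * l2norm r) := by
    simp_rw [norm_mul (p z)]
    rw [integral_const_mul, ← l2norm_comp_neg_add hr.1 (ℓ z)]
    exact mul_le_mul_of_nonneg_left (integral_norm_mul_le hq (memLp_comp_neg_add hr _))
      (norm_nonneg _)
  have hi : Integrable (fun z ↦ ∫ a, ‖p z * (q a * r (-(a + ℓ z)))‖) ν := by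
    refine (hp.norm.mul_const (l2norm q * l2norm r)).mono' ?_ (ae_of_all _ fun z ↦ ?_)
    · exact hm.norm.integral_prod_right'
    · rw [Real.norm_of_nonneg (integral_nonneg fun _ ↦ norm_nonneg _)]
      exact hb z
  have h : Integrable (fun x : Z × ℝ ↦ p x.1 * (q x.2 * r (-(x.2 + ℓ x.1))))
      (ν.prod volume) := by
    rw [integrable_prod_iff hm]
    exact ⟨ae_of_all _ fun z ↦
      (hq.integrable_mul (memLp_comp_neg_add hr (ℓ z))).const_mul (p z), hi⟩
  refine ⟨h, ?_⟩
  rw [integral_prod _ h.norm, ← integral_mul_const]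
  exact integral_mono hi (hp.norm.mul_const _) hb

/-- The cyclic permutation of the variables of the plane `a + b + c = 0`. -/
theorem measurePreserving_cycle₃ :
    MeasurePreserving (fun x : ℝ × ℝ ↦ (x.2, -(x.1 + x.2)))
      (volume.prod volume) (volume.prod volume) :=
  (measurePreserving_shear volume measurable_id).comp Measure.measurePreserving_swap

/-- The cyclic permutation of the variables of the space `a + b + c + d = 0`. -/
theorem measurePreserving_cycle₄ :
    MeasurePreserving (fun x : ℝ × ℝ × ℝ ↦ (x.2.1, x.2.2, -(x.1 + (x.2.1 + x.2.2))))
      (volume.prod (volume.prod volume)) (volume.prod (volume.prod volume)) :=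
  (measurePreserving_prodAssoc volume volume volume).comp
    ((measurePreserving_shear (volume.prod volume) (ℓ := fun y : ℝ × ℝ ↦ y.1 + y.2)
      (by fun_prop)).comp Measure.measurePreserving_swap)

end Multilinear

/-! ### Pointwise estimates for weights, commutators and symbols -/

section Symbols

/-- The angular frequency: `D` acts as multiplication by `freq ξ` on the Fourier side. -/
def freq (ξ : ℝ) : ℝ := 2 * Real.pi * ξ

/-- The symbol `⟨x⟩`. -/
def japanese (x : ℝ) : ℝ := √(1 + x ^ 2)

/-- The bounded exponential weight `exp (σ min(|x|, N))`. -/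
def expWeight (σ N x : ℝ) : ℝ := Real.exp (σ * min |x| N)

/-- The symbol of the quadratic nonlinearity, on the plane `x + y + z = 0` of frequencies. -/
def quadSymbol (x y z : ℝ) : ℝ := x * (3 / 4 - 7 / 48 * x ^ 2 + 7 / 48 * (y * z))

theorem japanese_sq (x : ℝ) : japanese x ^ 2 = 1 + x ^ 2 := Real.sq_sqrt (by positivity)

theorem one_le_japanese (x : ℝ) : 1 ≤ japanese x :=
  Real.one_le_sqrt.2 (by nlinarith [sq_nonneg x])

theorem japanese_pos (x : ℝ) : 0 < japanese x := one_pos.trans_le (one_le_japanese x)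

theorem abs_le_japanese (x : ℝ) : |x| ≤ japanese x :=
  Real.abs_le_sqrt (by linarith)

theorem expWeight_pos (σ N x : ℝ) : 0 < expWeight σ N x := Real.exp_pos _

theorem one_le_expWeight {σ N : ℝ} (hσ : 0 ≤ σ) (hN : 0 ≤ N) (x : ℝ) : 1 ≤ expWeight σ N x :=
  Real.one_le_exp (by positivity)

theorem expWeight_le {σ N : ℝ} (hσ : 0 ≤ σ) (x : ℝ) : expWeight σ N x ≤ Real.exp (σ * N) :=
  Real.exp_le_exp.2 (mul_le_mul_of_nonneg_left (min_le_right _ _) hσ)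

theorem expWeight_neg (σ N x : ℝ) : expWeight σ N (-x) = expWeight σ N x := by
  simp [expWeight]

@[fun_prop]
theorem continuous_freq : Continuous freq := by unfold freq; fun_prop

@[fun_prop]
theorem continuous_japanese : Continuous japanese := by unfold japanese; fun_prop

@[fun_prop]
theorem continuous_expWeight (σ N : ℝ) : Continuous (expWeight σ N) := by
  unfold expWeight; fun_prop

theorem freq_neg (ξ : ℝ) : freq (-ξ) = -freq ξ := by simp [freq]

theorem freq_add (ξ ζ : ℝ) : freq (ξ + ζ) = freq ξ + freq ζ := by simp [freq, mul_add]

/-- With d = v - u ≥ 0 this is 1 - exp(-d) ≤ d, multiplied by exp v. -/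
theorem abs_exp_sub_exp_le {u v : ℝ} (h : u ≤ v) :
    |Real.exp u - Real.exp v| ≤ (v - u) * Real.exp v := by
  have h1 := Real.add_one_le_exp (u - v)
  have h2 : Real.exp u = Real.exp (u - v) * Real.exp v := by rw [← Real.exp_add]; ring_nf
  rw [abs_of_nonpos (by linarith [Real.exp_le_exp.2 h]), h2]
  nlinarith [Real.exp_pos v]

/-- Truncation at `N` preserves the triangle inequality, so the bounded weight is still
submultiplicative, with constant one for every `N`. -/
theorem min_abs_le_add {N : ℝ} (hN : 0 ≤ N) {x y z : ℝ} (h : x + y + z = 0) :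
    min |x| N ≤ min |y| N + min |z| N := by
  have hx : |x| ≤ |y| + |z| := by
    rw [show x = -(y + z) by linarith, abs_neg]; exact abs_add_le _ _
  have := abs_nonneg y
  have := abs_nonneg z
  rcases le_total |y| N with h1 | h1 <;> rcases le_total |z| N with h2 | h2 <;>
    simp only [min_eq_left, min_eq_right, h1, h2] <;>
    first
    | exact (min_le_left _ _).trans hx
    | exact (min_le_right _ _).trans (by linarith)

theorem expWeight_mul₂ (σ N y z : ℝ) :
    expWeight σ N y * expWeight σ N z = Real.exp (σ * (min |y| N + min |z| N)) := by
  rw [expWeight, expWeight, ← Real.exp_add, mul_add]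

theorem expWeight_le_mul₂ {σ N : ℝ} (hσ : 0 ≤ σ) (hN : 0 ≤ N) {x y z : ℝ} (h : x + y + z = 0) :
    expWeight σ N x ≤ expWeight σ N y * expWeight σ N z := by
  rw [expWeight_mul₂]
  exact Real.exp_le_exp.2 (mul_le_mul_of_nonneg_left (min_abs_le_add hN h) hσ)

/-- The gap between the exponents is `min |y| N + min |z| N - min |x| N`. The triangle inequality
solved for the larger of y and z bounds it by twice the smaller. The factor `σ` gained here is the
source of the rate c/t. -/
theorem expWeight_commutator₂ {σ N : ℝ} (hσ : 0 ≤ σ) (hN : 0 ≤ N) {x y z : ℝ}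
    (h : x + y + z = 0) :
    |expWeight σ N x - expWeight σ N y * expWeight σ N z| ≤
      σ * (2 * min |y| |z|) * (expWeight σ N y * expWeight σ N z) := by
  rw [expWeight_mul₂, expWeight]
  refine (abs_exp_sub_exp_le (mul_le_mul_of_nonneg_left (min_abs_le_add hN h) hσ)).trans ?_
  refine mul_le_mul_of_nonneg_right ?_ (Real.exp_pos _).le
  rw [← mul_sub]
  refine mul_le_mul_of_nonneg_left ?_ hσ
  have h1 := min_abs_le_add hN (show y + z + x = 0 by linarith)
  have h2 := min_abs_le_add hN (show z + x + y = 0 by linarith)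
  rcases le_total |y| |z| with hyz | hyz
  · rw [min_eq_left hyz]; linarith [min_le_left |y| N]
  · rw [min_eq_right hyz]; linarith [min_le_left |z| N]

theorem expWeight_le_mul₃ {σ N : ℝ} (hσ : 0 ≤ σ) (hN : 0 ≤ N) {x y z u : ℝ}
    (h : x + y + z + u = 0) :
    expWeight σ N x ≤ expWeight σ N y * (expWeight σ N z * expWeight σ N u) := by
  refine (expWeight_le_mul₂ hσ hN (show x + y + (z + u) = 0 by linarith)).trans ?_
  refine mul_le_mul_of_nonneg_left ?_ (expWeight_pos _ _ _).le
  rw [← expWeight_neg]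
  refine expWeight_le_mul₂ hσ hN (by ring)

/-- A cruder bound than in the trilinear case is enough, since the quartic symbol has order one: the
exponent gap is estimated by dropping `min |x| N ≥ 0`. -/
theorem expWeight_commutator₃ {σ N : ℝ} (hσ : 0 ≤ σ) (hN : 0 ≤ N) {x y z u : ℝ}
    (h : x + y + z + u = 0) :
    |expWeight σ N x - expWeight σ N y * (expWeight σ N z * expWeight σ N u)| ≤
      σ * (|y| + |z| + |u|) * (expWeight σ N y * (expWeight σ N z * expWeight σ N u)) := by
  have hle := expWeight_le_mul₃ hσ hN h
  rw [expWeight_mul₂, expWeight, expWeight, ← Real.exp_add] at *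
  refine (abs_exp_sub_exp_le (Real.exp_le_exp.1 hle)).trans ?_
  refine mul_le_mul_of_nonneg_right ?_ (Real.exp_pos _).le
  rw [← mul_add, ← mul_sub]
  refine mul_le_mul_of_nonneg_left ?_ hσ
  have : 0 ≤ min |x| N := by positivity
  linarith [min_le_left |y| N, min_le_left |z| N, min_le_left |u| N]

/-- The majorant of the cubic form, in terms of Sobolev weights. -/
def cubicMajorant (x y z : ℝ) : ℝ :=
  japanese x ^ 2 * (japanese y ^ 2 * japanese z ^ 2) *
    ((japanese x)⁻¹ + (japanese y)⁻¹ + (japanese z)⁻¹)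

/-- Clearing the inverses leaves three monomials with exponents 2, 2, 1. The symbol estimates place
every term under one of them. -/
theorem cubicMajorant_eq (x y z : ℝ) : cubicMajorant x y z =
    japanese x * japanese y * japanese z *
      (japanese y * japanese z + japanese x * japanese z + japanese x * japanese y) := by
  have := (japanese_pos x).ne'
  have := (japanese_pos y).ne'
  have := (japanese_pos z).ne'
  unfold cubicMajorant
  field_simp

theorem abs_quadFactor_le (x y z : ℝ) :
    |3 / 4 - 7 / 48 * x ^ 2 + 7 / 48 * (y * z)| ≤ 3 / 4 + 7 / 48 * |x| ^ 2 + 7 / 48 * (|y| * |z|) := by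
  refine (abs_add_le _ _).trans (add_le_add ((abs_sub _ _).trans ?_) ?_)
  · rw [abs_mul, abs_pow]; norm_num
  · rw [abs_mul, abs_mul]; norm_num

/-- No weight occurs in the majorant to a power above two, so `|x| ^ 3` does not fit directly; one
factor `|x|` is traded for `|y| + |z|` through the constraint. -/
theorem abs_quadSymbol_le {x y z : ℝ} (h : x + y + z = 0) :
    |quadSymbol x y z| ≤ 2 * cubicMajorant x y z := by
  rw [cubicMajorant_eq, quadSymbol, abs_mul]
  have hx : |x| ≤ |y| + |z| := by
    rw [show x = -(y + z) by linarith, abs_neg]; exact abs_add_le _ _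
  have hf := abs_quadFactor_le x y z
  have := abs_le_japanese x
  have := abs_le_japanese y
  have := abs_le_japanese z
  have := one_le_japanese x
  have := one_le_japanese y
  have := one_le_japanese z
  have := abs_nonneg x
  have := abs_nonneg y
  have := abs_nonneg z
  generalize japanese x = s at *
  generalize japanese y = t at *
  generalize japanese z = r at *
  generalize |3 / 4 - 7 / 48 * x ^ 2 + 7 / 48 * (y * z)| = K at *
  generalize |x| = x at *
  generalize |y| = y at *
  generalize |z| = z at *
  have h0 : x ≤ s * t * r * (t * r) := calc
    x ≤ s * 1 * 1 * (1 * 1) := by linarith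
    _ ≤ s * t * r * (t * r) := by gcongr
  have h1 : x * (x * y) ≤ s * t * r * (s * t) := calc
    x * (x * y) ≤ s * (s * t) := by gcongr
    _ = s * 1 * 1 * (s * t) := by ring
    _ ≤ s * t * r * (s * t) := by gcongr
  have h2 : x * (x * z) ≤ s * t * r * (s * r) := calc
    x * (x * z) ≤ s * (s * r) := by gcongr
    _ = s * 1 * 1 * (s * r) := by ring
    _ ≤ s * t * r * (s * r) := by gcongr
  have h3 : x * (y * z) ≤ s * t * r * (t * r) := calc
    x * (y * z) ≤ s * (t * r) := by gcongr
    _ = s * 1 * 1 * (t * r) := by ring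
    _ ≤ s * t * r * (t * r) := by gcongr
  have h4 : x * x ^ 2 ≤ x * (x * y) + x * (x * z) := by
    have : x * x * x ≤ x * x * (y + z) := by gcongr
    nlinarith
  have h5 : x * K ≤ x * (3 / 4 + 7 / 48 * x ^ 2 + 7 / 48 * (y * z)) := by gcongr
  have h6 : 0 ≤ s * t * r * (s * r) := by positivity
  have h7 : 0 ≤ s * t * r * (s * t) := by positivity
  have h8 : 0 ≤ s * t * r * (t * r) := by positivity
  linarith

/-- Since |x| is at most twice the larger of |y| and |z|, the commutator factor `min |y| |z|` and
the outer factor `|x|` combine into at most `2 |y| |z|`. The remaining second-order factor then fits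
under the majorant. -/
theorem min_mul_abs_quadSymbol_le {x y z : ℝ} (h : x + y + z = 0) :
    2 * min |y| |z| * |quadSymbol x y z| ≤ 8 * cubicMajorant x y z := by
  rw [cubicMajorant_eq, quadSymbol, abs_mul]
  have hx : |x| ≤ |y| + |z| := by
    rw [show x = -(y + z) by linarith, abs_neg]; exact abs_add_le _ _
  have hf := abs_quadFactor_le x y z
  have := abs_le_japanese x
  have := abs_le_japanese y
  have := abs_le_japanese z
  have := one_le_japanese x
  have := one_le_japanese y
  have := one_le_japanese z
  have := abs_nonneg x
  have := abs_nonneg y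
  have := abs_nonneg z
  have hK := abs_nonneg (3 / 4 - 7 / 48 * x ^ 2 + 7 / 48 * (y * z))
  generalize japanese x = s at *
  generalize japanese y = t at *
  generalize japanese z = r at *
  generalize |3 / 4 - 7 / 48 * x ^ 2 + 7 / 48 * (y * z)| = K at *
  generalize |x| = x at *
  generalize |y| = y at *
  generalize |z| = z at *
  have hm : min y z * x ≤ 2 * (y * z) := by
    rcases le_total y z with hyz | hyz
    · rw [min_eq_left hyz]; nlinarith
    · rw [min_eq_right hyz]; nlinarith
  have h0 : y * z ≤ s * t * r * (t * r) := calc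
    y * z ≤ t * r := by gcongr
    _ = 1 * 1 * 1 * (t * r) := by ring
    _ ≤ s * t * r * (t * r) := by gcongr
  have h1 : y * z * x ^ 2 ≤ s * t * r * (s * t) := calc
    y * z * x ^ 2 ≤ t * r * s ^ 2 := by gcongr
    _ = s * t * r * (s * 1) := by ring
    _ ≤ s * t * r * (s * t) := by gcongr
  have h2 : y * z * (y * z) ≤ s * t * r * (t * r) := calc
    y * z * (y * z) ≤ t * r * (t * r) := by gcongr
    _ = 1 * t * r * (t * r) := by ring
    _ ≤ s * t * r * (t * r) := by gcongr
  have h5 : 2 * min y z * (x * K) ≤ 4 * (y * z) * (3 / 4 + 7 / 48 * x ^ 2 + 7 / 48 * (y * z)) := by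
    calc 2 * min y z * (x * K) = 2 * (min y z * x) * K := by ring
      _ ≤ 2 * (2 * (y * z)) * (3 / 4 + 7 / 48 * x ^ 2 + 7 / 48 * (y * z)) := by gcongr
      _ = _ := by ring
  have h6 : 0 ≤ s * t * r * (s * r) := by positivity
  have h7 : 0 ≤ s * t * r * (s * t) := by positivity
  have h8 : 0 ≤ s * t * r * (t * r) := by positivity
  linarith

/-- The majorant of the quartic form, in terms of Sobolev weights. -/
def quarticMajorant (x y z u : ℝ) : ℝ :=
  japanese x ^ 2 * (japanese y * japanese z * japanese u ^ 2)

theorem abs_le_quarticMajorant (x y z u : ℝ) : |x| ≤ quarticMajorant x y z u := by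
  have := abs_le_japanese x
  have h1 := one_le_japanese x
  have h2 := one_le_japanese y
  have h3 := one_le_japanese z
  have h4 := one_le_japanese u
  calc |x| ≤ japanese x * (1 * 1 * 1) := by linarith
    _ ≤ japanese x ^ 2 * (japanese y * japanese z * japanese u ^ 2) := by
      gcongr
      · exact le_self_pow₀ h1 two_ne_zero
      · exact one_le_pow₀ h4

theorem sum_mul_abs_le_quarticMajorant (x y z u : ℝ) :
    (|y| + |z| + |u|) * |x| ≤ 3 * quarticMajorant x y z u := by
  have := abs_le_japanese x
  have := abs_le_japanese y
  have := abs_le_japanese z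
  have := abs_le_japanese u
  have h1 := one_le_japanese x
  have h2 := one_le_japanese y
  have h3 := one_le_japanese z
  have h4 := one_le_japanese u
  unfold quarticMajorant
  generalize japanese x = s at *
  generalize japanese y = t at *
  generalize japanese z = r at *
  generalize japanese u = q at *
  have k1 : |y| ≤ t * r * q ^ 2 := calc
    |y| ≤ t * 1 * 1 := by linarith
    _ ≤ _ := by gcongr; exact one_le_pow₀ h4
  have k2 : |z| ≤ t * r * q ^ 2 := calc
    |z| ≤ 1 * r * 1 := by linarith
    _ ≤ _ := by gcongr; exact one_le_pow₀ h4
  have k3 : |u| ≤ t * r * q ^ 2 := calc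
    |u| ≤ 1 * 1 * q := by linarith
    _ ≤ _ := by gcongr; exact le_self_pow₀ h4 two_ne_zero
  have k4 : |x| ≤ s ^ 2 := le_trans (by assumption) (le_self_pow₀ h1 two_ne_zero)
  calc (|y| + |z| + |u|) * |x| ≤ (3 * (t * r * q ^ 2)) * s ^ 2 := by
        gcongr; linarith
    _ = _ := by ring

end Symbols

/-! ### Bounding the cubic and quartic majorants by the H² norm -/

section Forms

theorem integral_comp_of_measurePreserving {X Y E : Type*} [MeasurableSpace X] [MeasurableSpace Y]
    [NormedAddCommGroup E] [NormedSpace ℝ E] {μ : Measure X} {ν : Measure Y} {φ : X → Y}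
    (hφ : MeasurePreserving φ μ ν) {g : Y → E} (hg : AEStronglyMeasurable g ν) :
    ∫ x, g (φ x) ∂μ = ∫ y, g y ∂ν := by
  rw [← hφ.map_eq] at hg ⊢
  exact (integral_map hφ.measurable.aemeasurable hg).symm

/-- `⟨D⟩` on the Fourier side. -/
def bracket (ξ : ℝ) : ℝ := japanese (freq ξ)

@[fun_prop]
theorem continuous_bracket : Continuous bracket := by unfold bracket; fun_prop

theorem bracket_pos (ξ : ℝ) : 0 < bracket ξ := japanese_pos _

theorem bracket_sq (ξ : ℝ) : bracket ξ ^ 2 = 1 + freq ξ ^ 2 := japanese_sq _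

theorem one_le_bracket (ξ : ℝ) : 1 ≤ bracket ξ := one_le_japanese _

theorem memLp_inv_bracket : MemLp (fun ξ ↦ (bracket ξ)⁻¹) 2 volume := by
  have hc : Continuous fun ξ ↦ (bracket ξ)⁻¹ := continuous_bracket.inv₀ fun ξ ↦ (bracket_pos ξ).ne'
  rw [memLp_two_iff_integrable_sq hc.aestronglyMeasurable]
  have h := integrable_inv_one_add_sq.comp_mul_left' (R := 2 * Real.pi) (by positivity)
  refine h.congr (ae_of_all _ fun ξ ↦ ?_)
  simp only [inv_pow, bracket_sq, freq]

/-- The `L²` norm of `⟨D⟩⁻¹` on the Fourier side. -/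
def bracketConst : ℝ := l2norm fun ξ ↦ (bracket ξ)⁻¹

theorem bracketConst_nonneg : 0 ≤ bracketConst := l2norm_nonneg _

variable {V : ℝ → ℝ}

/-- Cauchy–Schwarz against `⟨κ⟩⁻¹ ∈ L²`: an H² function has one derivative with integrable Fourier
transform. The multilinear bounds spend this on all factors but two. -/
theorem integrable_bracket_mul (hV : MemLp (fun ξ ↦ bracket ξ ^ 2 * V ξ) 2 volume) :
    Integrable (fun ξ ↦ bracket ξ * V ξ) volume ∧
      ∫ ξ, ‖bracket ξ * V ξ‖ ≤ bracketConst * l2norm fun ξ ↦ bracket ξ ^ 2 * V ξ := by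
  have he : (fun ξ ↦ bracket ξ * V ξ) = fun ξ ↦ (bracket ξ)⁻¹ * (bracket ξ ^ 2 * V ξ) := by
    ext ξ
    have := (bracket_pos ξ).ne'
    field_simp
  have h1 := integral_norm_mul_le memLp_inv_bracket hV
  have h2 := memLp_inv_bracket.integrable_mul hV
  constructor
  · rw [he]; exact h2
  · simp_rw [congrFun he]; exact h1

/-- In each summand of the majorant, the variable of weight one is placed in L¹ and the two
variables of weight two in L². -/
theorem integrable_cubicMajorant (hVm : Measurable V)
    (hV : MemLp (fun ξ ↦ bracket ξ ^ 2 * V ξ) 2 volume) :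
    Integrable (fun x : ℝ × ℝ ↦ cubicMajorant (freq x.1) (freq x.2) (freq (-(x.1 + x.2))) *
      (V x.1 * (V x.2 * V (-(x.1 + x.2))))) (volume.prod volume) ∧
    ∫ x : ℝ × ℝ, ‖cubicMajorant (freq x.1) (freq x.2) (freq (-(x.1 + x.2))) *
      (V x.1 * (V x.2 * V (-(x.1 + x.2))))‖ ∂(volume.prod volume) ≤
        3 * (bracketConst * (l2norm fun ξ ↦ bracket ξ ^ 2 * V ξ) ^ 3) := by
  set F : ℝ → ℝ := fun ξ ↦ bracket ξ ^ 2 * V ξ with hF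
  have hFm : Measurable F := (continuous_bracket.pow 2).measurable.mul hVm
  set T : ℝ × ℝ → ℝ := fun x ↦ bracket x.1 * V x.1 * (F x.2 * F (-(x.2 + x.1))) with hT
  obtain ⟨hp1, hp2⟩ := integrable_bracket_mul hV
  obtain ⟨hi, hb⟩ := integrable_young (ℓ := id) measurable_id hp1 hV hV hFm
  replace hi : Integrable T (volume.prod volume) := hi
  replace hb : ∫ x, ‖T x‖ ∂(volume.prod volume) ≤ bracketConst * l2norm F ^ 3 :=
    hb.trans ((mul_le_mul_of_nonneg_right hp2
      (mul_nonneg (l2norm_nonneg _) (l2norm_nonneg _))).trans_eq (by ring))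
  set cyc : ℝ × ℝ → ℝ × ℝ := fun x ↦ (x.2, -(x.1 + x.2)) with hcyc
  have hc : MeasurePreserving cyc (volume.prod volume) (volume.prod volume) :=
    measurePreserving_cycle₃
  have hi1 : Integrable (fun x ↦ T (cyc x)) (volume.prod volume) := hc.integrable_comp_of_integrable hi
  have hi2 : Integrable (fun x ↦ T (cyc (cyc x))) (volume.prod volume) :=
    hc.integrable_comp_of_integrable hi1
  have he1 : ∫ x, ‖T (cyc x)‖ ∂(volume.prod volume) = ∫ x, ‖T x‖ ∂(volume.prod volume) :=
    integral_comp_of_measurePreserving hc hi.norm.1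
  have he2 : ∫ x, ‖T (cyc (cyc x))‖ ∂(volume.prod volume) = ∫ x, ‖T x‖ ∂(volume.prod volume) :=
    (integral_comp_of_measurePreserving hc hi1.norm.1).trans he1
  -- The three summands are a single function carried around by the cyclic permutation; they have
  -- equal integrals, whence the factor 3.
  have hsum : (fun x : ℝ × ℝ ↦ cubicMajorant (freq x.1) (freq x.2) (freq (-(x.1 + x.2))) *
      (V x.1 * (V x.2 * V (-(x.1 + x.2))))) = fun x ↦ T x + T (cyc x) + T (cyc (cyc x)) := by
    ext ⟨a, b⟩
    have e1 : -(-(a + b) + b) = a := by ring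
    have e2 : -(b + -(a + b)) = a := by ring
    have e3 : -(b + a) = -(a + b) := by ring
    have e4 : -(a + -(a + b)) = b := by ring
    simp only [hT, hcyc, hF, cubicMajorant, ← bracket.eq_def, e1, e2, e3, e4]
    have h1 := (bracket_pos a).ne'
    have h2 := (bracket_pos b).ne'
    have h3 := (bracket_pos (-(a + b))).ne'
    change bracket a ^ 2 * (bracket b ^ 2 * bracket (-(a + b)) ^ 2) *
      ((bracket a)⁻¹ + (bracket b)⁻¹ + (bracket (-(a + b)))⁻¹) * _ = _
    field_simp
  simp_rw [congrFun hsum]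
  refine ⟨(hi.add hi1).add hi2, ?_⟩
  calc ∫ x, ‖T x + T (cyc x) + T (cyc (cyc x))‖ ∂(volume.prod volume)
      ≤ ∫ x, (‖T x‖ + ‖T (cyc x)‖ + ‖T (cyc (cyc x))‖) ∂(volume.prod volume) :=
        integral_mono ((hi.add hi1).add hi2).norm ((hi.norm.add hi1.norm).add hi2.norm)
          fun x ↦ norm_add₃_le
    _ = 3 * ∫ x, ‖T x‖ ∂(volume.prod volume) := by
        rw [integral_add (by exact hi.norm.add hi1.norm) hi2.norm, integral_add hi.norm hi1.norm, he1, he2]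
        ring
    _ ≤ _ := by gcongr

/-- The two middle variables, of weight one, are placed in L¹; the first and the last, of weight
two, in L². -/
theorem integrable_quarticMajorant (hVm : Measurable V)
    (hV : MemLp (fun ξ ↦ bracket ξ ^ 2 * V ξ) 2 volume) :
    Integrable (fun x : ℝ × ℝ × ℝ ↦
      quarticMajorant (freq x.1) (freq x.2.1) (freq x.2.2) (freq (-(x.1 + (x.2.1 + x.2.2)))) *
      (V x.1 * (V x.2.1 * (V x.2.2 * V (-(x.1 + (x.2.1 + x.2.2)))))))
      (volume.prod (volume.prod volume)) ∧
    ∫ x : ℝ × ℝ × ℝ, ‖quarticMajorant (freq x.1) (freq x.2.1) (freq x.2.2)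
        (freq (-(x.1 + (x.2.1 + x.2.2)))) *
      (V x.1 * (V x.2.1 * (V x.2.2 * V (-(x.1 + (x.2.1 + x.2.2))))))‖
        ∂(volume.prod (volume.prod volume)) ≤
        bracketConst ^ 2 * (l2norm fun ξ ↦ bracket ξ ^ 2 * V ξ) ^ 4 := by
  set F : ℝ → ℝ := fun ξ ↦ bracket ξ ^ 2 * V ξ with hF
  have hFm : Measurable F := (continuous_bracket.pow 2).measurable.mul hVm
  obtain ⟨hp1, hp2⟩ := integrable_bracket_mul hV
  obtain ⟨hi, hb⟩ := integrable_young (ν := volume.prod volume)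
    (ℓ := fun y : ℝ × ℝ ↦ y.1 + y.2) (by fun_prop) (hp1.mul_prod hp1) hV hV hFm
  -- The swap turns the first variable into the fibre variable of `integrable_young`, with the two
  -- L¹ variables as base.
  have hsw : MeasurePreserving (Prod.swap : ℝ × (ℝ × ℝ) → (ℝ × ℝ) × ℝ)
      (volume.prod (volume.prod volume)) ((volume.prod volume).prod volume) :=
    Measure.measurePreserving_swap
  have hi' := hsw.integrable_comp_of_integrable hi
  have he := integral_comp_of_measurePreserving hsw hi.norm.1
  have hfun : (fun x : ℝ × ℝ × ℝ ↦
      quarticMajorant (freq x.1) (freq x.2.1) (freq x.2.2) (freq (-(x.1 + (x.2.1 + x.2.2)))) *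
      (V x.1 * (V x.2.1 * (V x.2.2 * V (-(x.1 + (x.2.1 + x.2.2))))))) = 
      (fun x : (ℝ × ℝ) × ℝ ↦ bracket x.1.1 * V x.1.1 * (bracket x.1.2 * V x.1.2) *
        (F x.2 * F (-(x.2 + (x.1.1 + x.1.2))))) ∘ Prod.swap := by
    ext ⟨a, b, d⟩
    simp only [Function.comp, Prod.swap, hF, quarticMajorant]
    simp only [bracket]
    ring
  rw [hfun]
  refine ⟨hi', ?_⟩
  rw [show (fun x : ℝ × ℝ × ℝ ↦
      ‖quarticMajorant (freq x.1) (freq x.2.1) (freq x.2.2) (freq (-(x.1 + (x.2.1 + x.2.2)))) *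
      (V x.1 * (V x.2.1 * (V x.2.2 * V (-(x.1 + (x.2.1 + x.2.2))))))‖) = _ from
      funext fun x ↦ congrArg norm (congrFun hfun x)]
  refine he.le.trans (hb.trans ?_)
  have hn : ∫ z : ℝ × ℝ, ‖bracket z.1 * V z.1 * (bracket z.2 * V z.2)‖ ∂(volume.prod volume) =
      (∫ ξ, ‖bracket ξ * V ξ‖) * ∫ ξ, ‖bracket ξ * V ξ‖ := by
    simp_rw [norm_mul (bracket _ * V _)]
    exact integral_prod_mul (fun ξ ↦ ‖bracket ξ * V ξ‖) (fun ξ ↦ ‖bracket ξ * V ξ‖)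
  rw [hn]
  have h0 : 0 ≤ ∫ ξ, ‖bracket ξ * V ξ‖ := integral_nonneg fun _ ↦ norm_nonneg _
  calc _ ≤ (bracketConst * l2norm F) * (bracketConst * l2norm F) * (l2norm F * l2norm F) := by
        gcongr
        · exact mul_nonneg (l2norm_nonneg _) (l2norm_nonneg _)
        · exact mul_nonneg bracketConst_nonneg (l2norm_nonneg _)
    _ = _ := by ring

end Forms

/-! ### Multilinear forms of the energy and their cancellations -/

section EnergyForms

theorem freq_sum₃ (a b : ℝ) : freq a + freq b + freq (-(a + b)) = 0 := by
  rw [freq_neg, freq_add]; ring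

theorem freq_sum₄ (a b d : ℝ) : freq a + freq b + freq d + freq (-(a + (b + d))) = 0 := by
  rw [freq_neg, freq_add, freq_add]; ring

/-- The convolution of two functions on the line. -/
def conv (f g : ℝ → ℂ) (ξ : ℝ) : ℂ := ∫ s, f s * g (ξ - s)

/-- The Fourier transform of the nonlinearity, in terms of the Fourier transform `f` of the
solution. -/
def nonlinHat (f : ℝ → ℂ) (ξ : ℝ) : ℂ :=
  -Complex.I * freq ξ * (3 / 4 - 7 / 48 * (freq ξ : ℂ) ^ 2) * conv f f ξ
    - Complex.I * freq ξ * (7 / 48) * conv (fun s ↦ freq s * f s) (fun s ↦ freq s * f s) ξ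
    + Complex.I * freq ξ * (1 / 8) * conv f (conv f f) ξ

/-- The symbol of the cubic form of the energy identity. -/
def triSymbol (x : ℝ × ℝ) : ℝ := quadSymbol (freq x.1) (freq x.2) (freq (-(x.1 + x.2)))

/-- The product `f(a) f(b) f(c)` on the plane `a + b + c = 0`. -/
def triProd (f : ℝ → ℂ) (x : ℝ × ℝ) : ℂ := f x.1 * (f x.2 * f (-(x.1 + x.2)))

/-- The product `f(a) f(b) f(c) f(d)` on the space `a + b + c + d = 0`. -/
def tetraProd (f : ℝ → ℂ) (x : ℝ × ℝ × ℝ) : ℂ :=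
  f x.1 * (f x.2.1 * (f x.2.2 * f (-(x.1 + (x.2.1 + x.2.2)))))

theorem measurable_triProd {f : ℝ → ℂ} (hf : Measurable f) : Measurable (triProd f) := by
  unfold triProd; fun_prop

theorem measurable_tetraProd {f : ℝ → ℂ} (hf : Measurable f) : Measurable (tetraProd f) := by
  unfold tetraProd; fun_prop

@[fun_prop]
theorem continuous_triSymbol : Continuous triSymbol := by
  unfold triSymbol quadSymbol; fun_prop

variable {v : ℝ → ℂ}

/-- Turns a pointwise symbol bound into integrability and a bound by the cube of the H² norm; it is
applied both with and without the commutator factor. -/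
theorem integrable_of_le_cubic (hvm : Measurable v)
    (hv : MemLp (fun ξ ↦ bracket ξ ^ 2 * ‖v ξ‖) 2 volume) {g : ℝ × ℝ → ℂ} (hg : Measurable g)
    {C : ℝ} (hC : 0 ≤ C)
    (h : ∀ a b, ‖g (a, b)‖ ≤ C * cubicMajorant (freq a) (freq b) (freq (-(a + b))) *
      ‖triProd v (a, b)‖) :
    Integrable g (volume.prod volume) ∧ ∫ x, ‖g x‖ ∂(volume.prod volume) ≤
      C * (3 * (bracketConst * (l2norm fun ξ ↦ bracket ξ ^ 2 * ‖v ξ‖) ^ 3)) := by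
  obtain ⟨hi, hb⟩ := integrable_cubicMajorant hvm.norm hv
  have hle (x : ℝ × ℝ) : ‖g x‖ ≤ C * ‖cubicMajorant (freq x.1) (freq x.2) (freq (-(x.1 + x.2))) *
      (‖v x.1‖ * (‖v x.2‖ * ‖v (-(x.1 + x.2))‖))‖ := by
    refine (h x.1 x.2).trans ?_
    rw [mul_assoc, triProd, norm_mul, norm_mul]
    exact mul_le_mul_of_nonneg_left (Real.le_norm_self _) hC
  have hgi : Integrable g (volume.prod volume) :=
    (hi.norm.const_mul C).mono' hg.aestronglyMeasurable (ae_of_all _ hle)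
  refine ⟨hgi, (integral_mono hgi.norm (hi.norm.const_mul C) hle).trans ?_⟩
  rw [integral_const_mul]
  exact mul_le_mul_of_nonneg_left hb hC

theorem integrable_of_le_quartic (hvm : Measurable v)
    (hv : MemLp (fun ξ ↦ bracket ξ ^ 2 * ‖v ξ‖) 2 volume) {g : ℝ × ℝ × ℝ → ℂ} (hg : Measurable g)
    {C : ℝ} (hC : 0 ≤ C)
    (h : ∀ a b d, ‖g (a, b, d)‖ ≤
      C * quarticMajorant (freq a) (freq b) (freq d) (freq (-(a + (b + d)))) *
      ‖tetraProd v (a, b, d)‖) :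
    Integrable g (volume.prod (volume.prod volume)) ∧
      ∫ x, ‖g x‖ ∂(volume.prod (volume.prod volume)) ≤
      C * (bracketConst ^ 2 * (l2norm fun ξ ↦ bracket ξ ^ 2 * ‖v ξ‖) ^ 4) := by
  obtain ⟨hi, hb⟩ := integrable_quarticMajorant hvm.norm hv
  have hle (x : ℝ × ℝ × ℝ) : ‖g x‖ ≤ C * ‖quarticMajorant (freq x.1) (freq x.2.1) (freq x.2.2)
      (freq (-(x.1 + (x.2.1 + x.2.2)))) *
      (‖v x.1‖ * (‖v x.2.1‖ * (‖v x.2.2‖ * ‖v (-(x.1 + (x.2.1 + x.2.2)))‖)))‖ := by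
    refine (h x.1 x.2.1 x.2.2).trans ?_
    rw [mul_assoc, tetraProd, norm_mul, norm_mul, norm_mul]
    exact mul_le_mul_of_nonneg_left (Real.le_norm_self _) hC
  have hgi : Integrable g (volume.prod (volume.prod volume)) :=
    (hi.norm.const_mul C).mono' hg.aestronglyMeasurable (ae_of_all _ hle)
  refine ⟨hgi, (integral_mono hgi.norm (hi.norm.const_mul C) hle).trans ?_⟩
  rw [integral_const_mul]
  exact mul_le_mul_of_nonneg_left hb hC

/-- Cancellation in the cubic part of the energy identity. -/
theorem integral_triSymbol_mul_triProd (hvm : Measurable v)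
    (hv : MemLp (fun ξ ↦ bracket ξ ^ 2 * ‖v ξ‖) 2 volume) :
    ∫ x, (triSymbol x : ℂ) * triProd v x ∂(volume.prod volume) = 0 := by
  set g : ℝ × ℝ → ℂ := fun x ↦ (triSymbol x : ℂ) * triProd v x with hg
  have hgm : Measurable g := by
    have := measurable_triProd hvm
    fun_prop
  have hi : Integrable g (volume.prod volume) := by
    refine (integrable_of_le_cubic hvm hv hgm zero_le_two fun a b ↦ ?_).1
    rw [hg, norm_mul, Complex.norm_real]
    exact mul_le_mul_of_nonneg_right (abs_quadSymbol_le (freq_sum₃ a b)) (norm_nonneg _)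
  set cyc : ℝ × ℝ → ℝ × ℝ := fun x ↦ (x.2, -(x.1 + x.2)) with hcyc
  have hc : MeasurePreserving cyc (volume.prod volume) (volume.prod volume) :=
    measurePreserving_cycle₃
  have hi1 := hc.integrable_comp_of_integrable hi
  have hi2 := hc.integrable_comp_of_integrable hi1
  have he1 : ∫ x, (g ∘ cyc) x ∂(volume.prod volume) = ∫ x, g x ∂(volume.prod volume) :=
    integral_comp_of_measurePreserving hc hi.1
  have he2 : ∫ x, ((g ∘ cyc) ∘ cyc) x ∂(volume.prod volume) = ∫ x, g x ∂(volume.prod volume) :=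
    (integral_comp_of_measurePreserving hc hi1.1).trans he1
  -- The integrand vanishes pointwise. On x + y + z = 0 the terms of degree one cancel by Σx = 0,
  -- and those of degree three because Σx³ = 3xyz = Σx·yz occur with opposite coefficients 7/48.
  have h0 : ∫ x, (g x + (g ∘ cyc) x + ((g ∘ cyc) ∘ cyc) x) ∂(volume.prod volume) = 0 := by
    rw [← integral_zero (ℝ × ℝ) ℂ (μ := volume.prod volume)]
    refine integral_congr_ae (ae_of_all _ fun ⟨a, b⟩ ↦ ?_)
    have e2 : -(b + -(a + b)) = a := by ring
    have e4 : -(-(a + b) + a) = b := by ring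
    have hs : freq (-(a + b)) = -(freq a + freq b) := by rw [freq_neg, freq_add]
    simp only [hg, hcyc, Function.comp, triSymbol, triProd, e2, e4, quadSymbol, hs]
    push_cast
    ring
  rw [integral_add (by exact hi.add hi1) hi2, integral_add hi hi1, he1, he2] at h0
  have : (3 : ℂ) * ∫ x, g x ∂(volume.prod volume) = 0 := by rw [← h0]; ring
  simpa using this

/-- Cancellation in the quartic part of the energy identity. -/
theorem integral_freq_mul_tetraProd (hvm : Measurable v)
    (hv : MemLp (fun ξ ↦ bracket ξ ^ 2 * ‖v ξ‖) 2 volume) :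
    ∫ x, (freq x.1 : ℂ) * tetraProd v x ∂(volume.prod (volume.prod volume)) = 0 := by
  set g : ℝ × ℝ × ℝ → ℂ := fun x ↦ (freq x.1 : ℂ) * tetraProd v x with hg
  set μ : Measure (ℝ × ℝ × ℝ) := volume.prod (volume.prod volume) with hμ
  have hgm : Measurable g := by
    have := measurable_tetraProd hvm
    fun_prop
  have hi : Integrable g μ := by
    refine (integrable_of_le_quartic hvm hv hgm zero_le_one fun a b d ↦ ?_).1
    rw [hg, norm_mul, Complex.norm_real, one_mul]
    exact mul_le_mul_of_nonneg_right (abs_le_quarticMajorant _ _ _ _) (norm_nonneg _)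
  set cyc : ℝ × ℝ × ℝ → ℝ × ℝ × ℝ := fun x ↦ (x.2.1, x.2.2, -(x.1 + (x.2.1 + x.2.2))) with hcyc
  have hc : MeasurePreserving cyc μ μ := measurePreserving_cycle₄
  have hi1 := hc.integrable_comp_of_integrable hi
  have hi2 := hc.integrable_comp_of_integrable hi1
  have hi3 := hc.integrable_comp_of_integrable hi2
  have he1 : ∫ x, (g ∘ cyc) x ∂μ = ∫ x, g x ∂μ :=
    integral_comp_of_measurePreserving hc hi.1
  have he2 : ∫ x, ((g ∘ cyc) ∘ cyc) x ∂μ = ∫ x, g x ∂μ :=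
    (integral_comp_of_measurePreserving hc hi1.1).trans he1
  have he3 : ∫ x, (((g ∘ cyc) ∘ cyc) ∘ cyc) x ∂μ = ∫ x, g x ∂μ :=
    (integral_comp_of_measurePreserving hc hi2.1).trans he2
  -- `tetraProd` is invariant under the cyclic permutation, and the four frequencies sum to zero.
  have h0 : ∫ x, (g x + (g ∘ cyc) x + ((g ∘ cyc) ∘ cyc) x + (((g ∘ cyc) ∘ cyc) ∘ cyc) x) ∂μ = 0 := by
    rw [← integral_zero (ℝ × ℝ × ℝ) ℂ (μ := μ)]
    refine integral_congr_ae (ae_of_all _ fun ⟨a, b, d⟩ ↦ ?_)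
    have e1 : -(b + (d + -(a + (b + d)))) = a := by ring
    have e2 : -(d + (-(a + (b + d)) + a)) = b := by ring
    have e3 : -(-(a + (b + d)) + (a + b)) = d := by ring
    have hs : freq (-(a + (b + d))) = -(freq a + (freq b + freq d)) := by
      rw [freq_neg, freq_add, freq_add]
    simp only [hg, hcyc, Function.comp, tetraProd, e1, e2, e3, hs]
    push_cast
    ring
  rw [integral_add (by exact (hi.add hi1).add hi2) hi3, integral_add (by exact hi.add hi1) hi2,
    integral_add hi hi1, he1, he2, he3] at h0
  have : (4 : ℂ) * ∫ x, g x ∂μ = 0 := by rw [← h0]; ring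
  simpa using this

end EnergyForms

/-! ### Flux of the weighted energy -/

section EnergyEstimate

open scoped ComplexConjugate

theorem memLp_of_bracket {f : ℝ → ℂ} (hfm : Measurable f)
    (hf : MemLp (fun ξ ↦ bracket ξ ^ 2 * ‖f ξ‖) 2 volume) {m : ℝ → ℂ} (hm : Measurable m)
    {C : ℝ} (hC : ∀ ξ, ‖m ξ‖ ≤ C * bracket ξ ^ 2) :
    MemLp (fun ξ ↦ m ξ * f ξ) 2 volume := by
  refine hf.of_le_mul (c := C) (hm.mul hfm).aestronglyMeasurable (ae_of_all _ fun ξ ↦ ?_)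
  rw [norm_mul, norm_mul, norm_norm, norm_pow, Real.norm_of_nonneg (bracket_pos ξ).le, ← mul_assoc]
  exact mul_le_mul_of_nonneg_right (hC ξ) (norm_nonneg _)

theorem abs_freq_le_bracket_sq (ξ : ℝ) : |freq ξ| ≤ bracket ξ ^ 2 :=
  (abs_le_japanese _).trans (le_self_pow₀ (one_le_bracket ξ) two_ne_zero)

theorem memLp_self_of_bracket {f : ℝ → ℂ} (hfm : Measurable f)
    (hf : MemLp (fun ξ ↦ bracket ξ ^ 2 * ‖f ξ‖) 2 volume) : MemLp f 2 volume := by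
  have := memLp_of_bracket hfm hf (m := fun _ ↦ 1) measurable_const (C := 1) fun ξ ↦ by
    rw [norm_one, one_mul]; exact one_le_pow₀ (one_le_bracket ξ)
  simpa using this

theorem memLp_freq_of_bracket {f : ℝ → ℂ} (hfm : Measurable f)
    (hf : MemLp (fun ξ ↦ bracket ξ ^ 2 * ‖f ξ‖) 2 volume) :
    MemLp (fun ξ ↦ (freq ξ : ℂ) * f ξ) 2 volume :=
  memLp_of_bracket hfm hf (by fun_prop) (C := 1) fun ξ ↦ by
    simpa using abs_freq_le_bracket_sq ξ

variable {f : ℝ → ℂ} {w : ℝ → ℝ}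

/-- The frequency `-a` is chosen because Hermitian symmetry turns the conjugate of `f (-a)` into `f
a`; the convolutions at `-a` then become integrals of `triProd` and `tetraProd` over the remaining
variables. The hypothesis `ha` serves Fubini in the quartic term. -/
theorem nonlinHat_neg_eq (hfm : Measurable f)
    (hf : MemLp (fun ξ ↦ bracket ξ ^ 2 * ‖f ξ‖) 2 volume) (W : ℂ) (a : ℝ)
    (ha : Integrable (fun y ↦ tetraProd f (a, y)) (volume.prod volume)) :
    W * (f a * nonlinHat f (-a)) =
      Complex.I * (∫ b, W * ((triSymbol (a, b) : ℂ) * triProd f (a, b))) -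
      Complex.I * (1 / 8) *
        ∫ y, W * ((freq a : ℂ) * tetraProd f (a, y)) ∂(volume.prod volume) := by
  have h2 := memLp_self_of_bracket hfm hf
  have h3 := memLp_freq_of_bracket hfm hf
  have i1 : Integrable (fun b ↦ f b * f (-a - b)) volume := by
    have := h2.integrable_mul (memLp_comp_neg_add h2 a)
    refine this.congr (ae_of_all _ fun b ↦ ?_)
    simp only [Pi.mul_apply, show -(b + a) = -a - b by ring]
  have i2 : Integrable (fun b ↦ (freq b * f b) * (freq (-a - b) * f (-a - b))) volume := by
    have := h3.integrable_mul (memLp_comp_neg_add h3 a)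
    refine this.congr (ae_of_all _ fun b ↦ ?_)
    simp only [Pi.mul_apply, show -(b + a) = -a - b by ring]
  have e1 : ∫ b, W * ((triSymbol (a, b) : ℂ) * triProd f (a, b)) =
      W * f a * freq a * (3 / 4 - 7 / 48 * (freq a : ℂ) ^ 2) * conv f f (-a) +
      W * f a * freq a * (7 / 48) * conv (fun s ↦ freq s * f s) (fun s ↦ freq s * f s) (-a) := by
    unfold conv
    rw [← integral_const_mul, ← integral_const_mul, ← integral_add (i1.const_mul _) (i2.const_mul _)]
    refine integral_congr_ae (ae_of_all _ fun b ↦ ?_)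
    simp only [triSymbol, triProd, quadSymbol, show -(a + b) = -a - b by ring]
    push_cast
    ring
  have e2 : ∫ y, W * ((freq a : ℂ) * tetraProd f (a, y)) ∂(volume.prod volume) =
      W * freq a * f a * conv f (conv f f) (-a) := by
    rw [integral_const_mul, integral_const_mul, integral_prod _ ha]
    have : ∀ b, ∫ d, tetraProd f (a, b, d) = f a * (f b * conv f f (-a - b)) := fun b ↦ by
      unfold conv tetraProd
      rw [← integral_const_mul, ← integral_const_mul]
      refine integral_congr_ae (ae_of_all _ fun d ↦ ?_)
      simp [show -(a + (b + d)) = -a - b - d by ring]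
    simp_rw [this]
    rw [integral_const_mul]
    change _ * (_ * (_ * conv f (conv f f) (-a))) = _
    ring
  rw [e1, e2, nonlinHat, freq_neg]
  push_cast
  ring

/-- The nonlinear contribution to the time derivative of the energy density on the Fourier side. -/
def energyFlux (f : ℝ → ℂ) (w : ℝ → ℝ) (ξ : ℝ) : ℂ :=
  (w ξ : ℂ) ^ 2 * (conj (f ξ) * nonlinHat f ξ)

theorem expWeight_freq_measurable (σ N : ℝ) : Measurable fun ξ ↦ expWeight σ N (freq ξ) := by
  fun_prop

/-- The middle bound does without cancellation and has no factor `σ`; it serves as a dominating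
bound when the frequency cutoff is removed. The last one uses cancellation, and its factor `σ`
drives the theorem. The constants are 2·3, 1/8, 8·3 and 3/8, from the symbol bounds and the factor 3
of the cubic majorant. -/
theorem energyFlux_estimate {σ N : ℝ} (hσ : 0 ≤ σ) (hN : 0 ≤ N) (hfm : Measurable f)
    (hf : MemLp (fun ξ ↦ bracket ξ ^ 2 * ‖f ξ‖) 2 volume)
    (hconj : ∀ᵐ ξ, f (-ξ) = conj (f ξ)) {n : ℝ}
    (hn : n = l2norm fun ξ ↦ bracket ξ ^ 2 * ‖(expWeight σ N (freq ξ) : ℂ) * f ξ‖) :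
    Integrable (energyFlux f fun ξ ↦ expWeight σ N (freq ξ)) volume ∧
    ∫ ξ, ‖energyFlux f (fun ξ ↦ expWeight σ N (freq ξ)) ξ‖ ≤
      6 * (bracketConst * n ^ 3) + 1 / 8 * (bracketConst ^ 2 * n ^ 4) ∧
    ‖∫ ξ, energyFlux f (fun ξ ↦ expWeight σ N (freq ξ)) ξ‖ ≤
      σ * (24 * (bracketConst * n ^ 3) + 3 / 8 * (bracketConst ^ 2 * n ^ 4)) := by
  set w : ℝ → ℝ := fun ξ ↦ expWeight σ N (freq ξ) with hw
  have hwm : Measurable w := expWeight_freq_measurable σ N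
  have hw1 (ξ : ℝ) : 1 ≤ w ξ := one_le_expWeight hσ hN _
  have hw0 (ξ : ℝ) : 0 < w ξ := expWeight_pos _ _ _
  set v : ℝ → ℂ := fun ξ ↦ (w ξ : ℂ) * f ξ with hv
  have hvm : Measurable v := by fun_prop
  have hvn (ξ : ℝ) : ‖v ξ‖ = w ξ * ‖f ξ‖ := by
    rw [hv, norm_mul, Complex.norm_real, Real.norm_of_nonneg (hw0 ξ).le]
  -- This is where truncation of the weight matters: it is bounded by exp(σN), so `v` inherits H²
  -- regularity from `f`.
  have hvL : MemLp (fun ξ ↦ bracket ξ ^ 2 * ‖v ξ‖) 2 volume := by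
    refine hf.of_le_mul (c := Real.exp (σ * N)) (by fun_prop) (ae_of_all _ fun ξ ↦ ?_)
    rw [norm_mul, norm_norm, hvn, norm_mul _ ‖f ξ‖, norm_norm]
    calc _ = w ξ * (‖bracket ξ ^ 2‖ * ‖f ξ‖) := by ring
      _ ≤ _ := by gcongr; exact expWeight_le hσ _
  have hn' : n = l2norm fun ξ ↦ bracket ξ ^ 2 * ‖v ξ‖ := hn
  have hn0 : 0 ≤ n := hn ▸ l2norm_nonneg _
  have hb0 := bracketConst_nonneg
  have htm := measurable_triProd hfm
  have htm4 := measurable_tetraProd hfm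
  have htv := measurable_triProd hvm
  have htv4 := measurable_tetraProd hvm
  set M₃ : ℝ × ℝ → ℂ := fun x ↦ (w x.1 : ℂ) ^ 2 * ((triSymbol x : ℂ) * triProd f x) with hM₃
  set M₄ : ℝ × ℝ × ℝ → ℂ := fun x ↦ (w x.1 : ℂ) ^ 2 * ((freq x.1 : ℂ) * tetraProd f x) with hM₄
  have hM₃m : Measurable M₃ := by fun_prop
  have hM₄m : Measurable M₄ := by fun_prop
  have nv3 (a b : ℝ) : ‖triProd v (a, b)‖ =
      w a * (w b * w (-(a + b))) * ‖triProd f (a, b)‖ := by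
    simp only [triProd, norm_mul, hvn]; ring
  have nv4 (a b d : ℝ) : ‖tetraProd v (a, b, d)‖ =
      w a * (w b * (w d * w (-(a + (b + d))))) * ‖tetraProd f (a, b, d)‖ := by
    simp only [tetraProd, norm_mul, hvn]; ring
  have nw (a : ℝ) : ‖(w a : ℂ) ^ 2‖ = w a ^ 2 := by
    rw [norm_pow, Complex.norm_real, Real.norm_of_nonneg (hw0 a).le]
  -- One of the two factors `w a` is replaced by `w b * w (-(a + b))`, which makes up the product
  -- for `v`.
  obtain ⟨i3, b3⟩ := integrable_of_le_cubic hvm hvL hM₃m zero_le_two fun a b ↦ by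
    rw [hM₃, norm_mul, norm_mul, Complex.norm_real, nv3, nw]
    have h1 := expWeight_le_mul₂ hσ hN (freq_sum₃ a b)
    have h2 : |triSymbol (a, b)| ≤ _ := abs_quadSymbol_le (freq_sum₃ a b)
    have := hw0 a
    calc w a ^ 2 * (|triSymbol (a, b)| * ‖triProd f (a, b)‖)
        = |triSymbol (a, b)| * (w a * w a * ‖triProd f (a, b)‖) := by ring
      _ ≤ _ := by gcongr; exact (abs_nonneg _).trans h2
  obtain ⟨i4, b4⟩ := integrable_of_le_quartic hvm hvL hM₄m zero_le_one fun a b d ↦ by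
    rw [hM₄, norm_mul, norm_mul, Complex.norm_real, nv4, nw, one_mul]
    have h1 := expWeight_le_mul₃ hσ hN (freq_sum₄ a b d)
    have h2 := abs_le_quarticMajorant (freq a) (freq b) (freq d) (freq (-(a + (b + d))))
    have := hw0 a
    calc w a ^ 2 * (|freq a| * ‖tetraProd f (a, b, d)‖)
        = |freq a| * (w a * w a * ‖tetraProd f (a, b, d)‖) := by ring
      _ ≤ _ := by gcongr; exact (abs_nonneg _).trans h2
  have hae : ∀ᵐ a, energyFlux f w (-a) =
      Complex.I * (∫ b, M₃ (a, b)) - Complex.I * (1 / 8) * ∫ y, M₄ (a, y) ∂(volume.prod volume) := by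
    -- The quartic majorant is at least one, so the unweighted product is dominated as well.
    have hiv : Integrable (tetraProd f) (volume.prod (volume.prod volume)) := by
      have hi0 : Integrable (fun x ↦ tetraProd f x) (volume.prod (volume.prod volume)) := by
        refine (integrable_of_le_quartic hfm hf htm4 zero_le_one fun a b d ↦ ?_).1
        refine le_mul_of_one_le_left (norm_nonneg _) ?_
        rw [one_mul, quarticMajorant]
        have h1 := one_le_japanese (freq a)
        have h2 := one_le_japanese (freq b)
        have h3 := one_le_japanese (freq d)
        have h4 := one_le_japanese (freq (-(a + (b + d))))
        have h5 := one_le_pow₀ h1 (n := 2)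
        have h6 := one_le_pow₀ h4 (n := 2)
        exact one_le_mul_of_one_le_of_one_le h5
          (one_le_mul_of_one_le_of_one_le (one_le_mul_of_one_le_of_one_le h2 h3) h6)
      exact hi0
    filter_upwards [hiv.prod_right_ae, hconj] with a ha hca
    have hwn : w (-a) = w a := by simp only [hw, freq_neg, expWeight_neg]
    rw [energyFlux, hwn, hca, Complex.conj_conj, nonlinHat_neg_eq hfm hf _ a ha]
  have i3' := i3.integral_prod_left
  have i4' := i4.integral_prod_left
  have iR : Integrable (fun a ↦ Complex.I * (∫ b, M₃ (a, b)) -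
      Complex.I * (1 / 8) * ∫ y, M₄ (a, y) ∂(volume.prod volume)) volume :=
    (i3'.const_mul _).sub (i4'.const_mul _)
  have iN : Integrable (fun a ↦ energyFlux f w (-a)) volume :=
    iR.congr (hae.mono fun a ha ↦ ha.symm)
  refine ⟨by simpa using iN.comp_neg, ?_, ?_⟩
  · rw [← integral_neg_eq_self]
    calc ∫ a, ‖energyFlux f w (-a)‖ ≤
        ∫ a, ((∫ b, ‖M₃ (a, b)‖) + 1 / 8 * ∫ y, ‖M₄ (a, y)‖ ∂(volume.prod volume)) := by
          refine integral_mono_ae iN.norm (i3.norm.integral_prod_left.add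
            (i4.norm.integral_prod_left.const_mul _)) (hae.mono fun a ha ↦ ?_)
          simp only [ha]
          refine (norm_sub_le _ _).trans (add_le_add ?_ ?_)
          · rw [norm_mul, Complex.norm_I, one_mul]
            exact norm_integral_le_integral_norm _
          · rw [norm_mul, norm_mul, Complex.norm_I, one_mul]
            norm_num
            exact norm_integral_le_integral_norm _
      _ = (∫ x, ‖M₃ x‖ ∂(volume.prod volume)) +
          1 / 8 * ∫ x, ‖M₄ x‖ ∂(volume.prod (volume.prod volume)) := by
          rw [integral_add i3.norm.integral_prod_left (i4.norm.integral_prod_left.const_mul _),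
            integral_const_mul, integral_prod _ i3.norm, integral_prod _ i4.norm]
      _ ≤ _ := by rw [← hn'] at b3 b4; linarith
  · have eq0 : ∫ ξ, energyFlux f w ξ = Complex.I * (∫ x, M₃ x ∂(volume.prod volume)) -
        Complex.I * (1 / 8) * ∫ x, M₄ x ∂(volume.prod (volume.prod volume)) := by
      rw [← integral_neg_eq_self, integral_congr_ae hae, integral_sub (i3'.const_mul _)
        (i4'.const_mul _), integral_const_mul, integral_const_mul, integral_prod _ i3,
        integral_prod _ i4]
    -- `R₃` and `R₄` are `M₃` and `M₄` minus the same forms for `v`; the latter have integral zero,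
    -- so only commutators remain.
    set R₃ : ℝ × ℝ → ℂ := fun x ↦ ((w x.1 * (w x.1 - w x.2 * w (-(x.1 + x.2))) : ℝ) : ℂ) *
      ((triSymbol x : ℂ) * triProd f x) with hR₃
    set R₄ : ℝ × ℝ × ℝ → ℂ := fun x ↦
      ((w x.1 * (w x.1 - w x.2.1 * (w x.2.2 * w (-(x.1 + (x.2.1 + x.2.2))))) : ℝ) : ℂ) *
      ((freq x.1 : ℂ) * tetraProd f x) with hR₄
    have hR₃m : Measurable R₃ := by fun_prop
    have hR₄m : Measurable R₄ := by fun_prop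
    obtain ⟨j3, c3⟩ := integrable_of_le_cubic hvm hvL hR₃m (C := σ * 8) (by positivity)
      fun a b ↦ by
        rw [hR₃, norm_mul, norm_mul, Complex.norm_real, Complex.norm_real, nv3, Real.norm_eq_abs,
          abs_mul, abs_of_pos (hw0 a)]
        have h1 := expWeight_commutator₂ hσ hN (freq_sum₃ a b)
        have h2 := min_mul_abs_quadSymbol_le (freq_sum₃ a b)
        have := hw0 a
        have := hw0 b
        have := hw0 (-(a + b))
        calc w a * |w a - w b * w (-(a + b))| * (|triSymbol (a, b)| * ‖triProd f (a, b)‖)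
            ≤ w a * (σ * (2 * min |freq b| |freq (-(a + b))|) * (w b * w (-(a + b)))) *
              (|triSymbol (a, b)| * ‖triProd f (a, b)‖) := by gcongr
          _ = σ * (2 * min |freq b| |freq (-(a + b))| * |triSymbol (a, b)|) *
              (w a * (w b * w (-(a + b))) * ‖triProd f (a, b)‖) := by ring
          _ ≤ σ * (8 * cubicMajorant (freq a) (freq b) (freq (-(a + b)))) *
              (w a * (w b * w (-(a + b))) * ‖triProd f (a, b)‖) := by
              refine mul_le_mul_of_nonneg_right (mul_le_mul_of_nonneg_left h2 hσ) (by positivity)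
          _ = _ := by ring
    obtain ⟨j4, c4⟩ := integrable_of_le_quartic hvm hvL hR₄m (C := σ * 3) (by positivity)
      fun a b d ↦ by
        rw [hR₄, norm_mul, norm_mul, Complex.norm_real, Complex.norm_real, nv4, Real.norm_eq_abs,
          abs_mul, abs_of_pos (hw0 a)]
        have h1 := expWeight_commutator₃ hσ hN (freq_sum₄ a b d)
        have h2 := sum_mul_abs_le_quarticMajorant (freq a) (freq b) (freq d)
          (freq (-(a + (b + d))))
        have := hw0 a
        have := hw0 b
        have := hw0 d
        have := hw0 (-(a + (b + d)))
        calc w a * |w a - w b * (w d * w (-(a + (b + d))))| *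
              (|freq a| * ‖tetraProd f (a, b, d)‖)
            ≤ w a * (σ * (|freq b| + |freq d| + |freq (-(a + (b + d)))|) *
              (w b * (w d * w (-(a + (b + d)))))) *
              (|freq a| * ‖tetraProd f (a, b, d)‖) := by gcongr
          _ = σ * ((|freq b| + |freq d| + |freq (-(a + (b + d)))|) * |freq a|) *
              (w a * (w b * (w d * w (-(a + (b + d))))) * ‖tetraProd f (a, b, d)‖) := by ring
          _ ≤ σ * (3 * quarticMajorant (freq a) (freq b) (freq d) (freq (-(a + (b + d))))) *
              (w a * (w b * (w d * w (-(a + (b + d))))) * ‖tetraProd f (a, b, d)‖) := by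
              refine mul_le_mul_of_nonneg_right (mul_le_mul_of_nonneg_left h2 hσ) (by positivity)
          _ = _ := by ring
    have z3 : ∫ x, M₃ x ∂(volume.prod volume) = ∫ x, R₃ x ∂(volume.prod volume) := by
      rw [← sub_eq_zero, ← integral_sub i3 j3, ← integral_triSymbol_mul_triProd hvm hvL]
      refine integral_congr_ae (ae_of_all _ fun x ↦ ?_)
      simp only [hM₃, hR₃, triProd, hv]
      push_cast
      ring
    have z4 : ∫ x, M₄ x ∂(volume.prod (volume.prod volume)) =
        ∫ x, R₄ x ∂(volume.prod (volume.prod volume)) := by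
      rw [← sub_eq_zero, ← integral_sub i4 j4, ← integral_freq_mul_tetraProd hvm hvL]
      refine integral_congr_ae (ae_of_all _ fun x ↦ ?_)
      simp only [hM₄, hR₄, tetraProd, hv]
      push_cast
      ring
    rw [eq0, z3, z4]
    have k3 := (norm_integral_le_integral_norm R₃).trans c3
    have k4 := (norm_integral_le_integral_norm R₄).trans c4
    rw [← hn'] at k3 k4
    calc _ ≤ ‖∫ x, R₃ x ∂(volume.prod volume)‖ +
          1 / 8 * ‖∫ x, R₄ x ∂(volume.prod (volume.prod volume))‖ := by
          refine (norm_sub_le _ _).trans_eq ?_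
          simp only [norm_mul, Complex.norm_I, one_mul]
          norm_num
      _ ≤ _ := by linarith

end EnergyEstimate

/-! ### Duality between functions and their Fourier transforms -/

section FourierPairing

open scoped ComplexConjugate ContDiff

theorem fourierL2_pairing (η : L2) (χ : 𝓢(ℝ, ℂ)) :
    ∫ x, (η x : ℂ) * (𝓕 χ : 𝓢(ℝ, ℂ)) x = ∫ ξ, fourierL2 η ξ * χ ξ := by
  have h := Lp.fourier_toTemperedDistribution_eq
    (Complex.ofRealCLM.compLp η : Lp ℂ 2 (volume : Measure ℝ))
  have h' := DFunLike.congr_fun h χ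
  rw [TemperedDistribution.fourier_apply, Lp.toTemperedDistribution_apply,
    Lp.toTemperedDistribution_apply] at h'
  calc ∫ x, (η x : ℂ) * (𝓕 χ : 𝓢(ℝ, ℂ)) x = ∫ x, (𝓕 χ : 𝓢(ℝ, ℂ)) x • (Complex.ofRealCLM.compLp η) x := by
        refine integral_congr_ae ?_
        filter_upwards [Complex.ofRealCLM.coeFn_compLp η] with x hx
        rw [hx, smul_eq_mul, mul_comm]
        rfl
    _ = ∫ ξ, χ ξ • fourierL2 η ξ := h'
    _ = _ := by simp_rw [smul_eq_mul, mul_comm]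

theorem integrable_mul_schwartz {g : ℝ → ℂ} (hg : Integrable g volume) (χ : 𝓢(ℝ, ℂ)) :
    Integrable (fun x ↦ g x * χ x) volume :=
  hg.mul_bdd χ.continuous.aestronglyMeasurable
    (ae_of_all _ (χ.norm_le_seminorm ℝ))

theorem integrable_mul_schwartz_of_memLp {g : ℝ → ℂ} (hg : MemLp g 2 volume) (χ : 𝓢(ℝ, ℂ)) :
    Integrable (fun x ↦ g x * χ x) volume :=
  hg.integrable_mul (χ.memLp 2)

/-- Fubini moves the inverse kernel onto the test function, where Fourier inversion applies.
Compared with `fourierL2_pairing`, it identifies the L² transform with the integral one when the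
transform is integrable. -/
theorem integral_fourierInv_mul_fourier {g : ℝ → ℂ} (hg : Integrable g volume) (χ : 𝓢(ℝ, ℂ)) :
    ∫ x, 𝓕⁻ g x * (𝓕 χ : 𝓢(ℝ, ℂ)) x = ∫ ξ, g ξ * χ ξ := by
  have h := VectorFourier.integral_fourierIntegral_smul_eq_flip (e := Real.fourierChar)
    (μ := volume) (ν := volume) (L := -innerₗ ℝ) (f := g) (g := (𝓕 χ : 𝓢(ℝ, ℂ)))
    Real.continuous_fourierChar (continuous_inner (𝕜 := ℝ) (E := ℝ)).neg hg
    (𝓕 χ : 𝓢(ℝ, ℂ)).integrable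
  have hflip : ∀ x, VectorFourier.fourierIntegral Real.fourierChar volume
      (-innerₗ ℝ : ℝ →ₗ[ℝ] ℝ →ₗ[ℝ] ℝ).flip (𝓕 χ : 𝓢(ℝ, ℂ)) x = χ x := by
    intro x
    have h1 : 𝓕⁻ (𝓕 χ) = χ := FourierTransform.fourierInv_fourier_eq χ
    have h2 := DFunLike.congr_fun h1 x
    rw [SchwartzMap.fourierInv_coe] at h2
    rw [← h2, Real.fourierInv_eq]
    unfold VectorFourier.fourierIntegral
    refine integral_congr_ae (ae_of_all _ fun y ↦ ?_)
    simp [mul_comm]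
  simp only [hflip, smul_eq_mul] at h
  rw [← h]
  refine integral_congr_ae (ae_of_all _ fun x ↦ ?_)
  simp only
  rw [Real.fourierInv_eq]
  unfold VectorFourier.fourierIntegral
  simp

/-- Locally integrable functions are determined by their pairings with Schwartz functions. -/
theorem ae_eq_of_pairing_eq {g h : ℝ → ℂ} (hg : LocallyIntegrable g volume)
    (hh : LocallyIntegrable h volume)
    (H : ∀ χ : 𝓢(ℝ, ℂ), ∫ x, g x * χ x = ∫ x, h x * χ x) : ∀ᵐ x, g x = h x := by
  refine ae_eq_of_integral_contDiff_smul_eq hg hh fun φ hφ hc ↦ ?_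
  have hc' : HasCompactSupport (Complex.ofRealCLM ∘ φ) := hc.comp_left rfl
  have hφ' : ContDiff ℝ ∞ (Complex.ofRealCLM ∘ φ) := by fun_prop
  have := H (hc'.toSchwartzMap hφ')
  simpa [mul_comm] using this

theorem ae_eq_of_fourier_pairing_eq {g h : ℝ → ℂ} (hg : LocallyIntegrable g volume)
    (hh : LocallyIntegrable h volume)
    (H : ∀ χ : 𝓢(ℝ, ℂ), ∫ x, g x * (𝓕 χ : 𝓢(ℝ, ℂ)) x = ∫ x, h x * (𝓕 χ : 𝓢(ℝ, ℂ)) x) : ∀ᵐ x, g x = h x := by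
  refine ae_eq_of_pairing_eq hg hh fun χ ↦ ?_
  have := H (𝓕⁻ χ)
  rwa [FourierTransform.fourier_fourierInv_eq χ] at this

theorem continuous_fourierInv {g : ℝ → ℂ} (hg : Integrable g volume) : Continuous (𝓕⁻ g) := by
  have h : 𝓕⁻ g = fun x ↦ 𝓕 g (-x) := funext fun x ↦ Real.fourierInv_eq_fourier_neg g x
  rw [h]
  exact (VectorFourier.fourierIntegral_continuous Real.continuous_fourierChar
    (by exact continuous_inner) hg).comp continuous_neg

theorem norm_fourierInv_le {g : ℝ → ℂ} (x : ℝ) : ‖𝓕⁻ g x‖ ≤ ∫ ξ, ‖g ξ‖ := by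
  rw [Real.fourierInv_eq_fourier_neg]
  exact VectorFourier.norm_fourierIntegral_le_integral_norm _ _ _ _ _

theorem locallyIntegrable_ofReal (η : L2) : LocallyIntegrable (fun x ↦ (η x : ℂ)) volume :=
  ((Lp.memLp η).ofReal (K := ℂ)).locallyIntegrable one_le_two

theorem ae_eq_fourierInv (η : L2) (hf : Integrable (fourierL2 η) volume) :
    ∀ᵐ x, (η x : ℂ) = 𝓕⁻ (fourierL2 η : ℝ → ℂ) x :=
  ae_eq_of_fourier_pairing_eq (locallyIntegrable_ofReal η)
    (continuous_fourierInv hf).locallyIntegrable fun χ ↦ by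
    rw [fourierL2_pairing, integral_fourierInv_mul_fourier hf]

/-- The Fourier transform of a real-valued function is Hermitian. -/
theorem fourierL2_neg (η : L2) : ∀ᵐ ξ, fourierL2 η (-ξ) = conj (fourierL2 η ξ) := by
  have hl := (Lp.memLp (fourierL2 η))
  have hl1 : LocallyIntegrable (fun ξ ↦ fourierL2 η (-ξ)) volume :=
    (hl.comp_measurePreserving (Measure.measurePreserving_neg volume)).locallyIntegrable one_le_two
  have hl2 : LocallyIntegrable (fun ξ ↦ conj (fourierL2 η ξ)) volume :=
    hl.star.locallyIntegrable one_le_two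
  refine ae_eq_of_integral_contDiff_smul_eq hl1 hl2 fun φ hφ hc ↦ ?_
  have hc' : HasCompactSupport (Complex.ofRealCLM ∘ φ) := hc.comp_left rfl
  have hφ' : ContDiff ℝ ∞ (Complex.ofRealCLM ∘ φ) := by fun_prop
  set χ : 𝓢(ℝ, ℂ) := hc'.toSchwartzMap hφ' with hχ
  set χ' : 𝓢(ℝ, ℂ) :=
    SchwartzMap.compCLMOfContinuousLinearEquiv ℝ (ContinuousLinearEquiv.neg ℝ) χ with hχ'
  have hv : ∀ x, χ x = (φ x : ℂ) := fun x ↦ rfl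
  have hv' : ∀ x, χ' x = (φ (-x) : ℂ) := fun x ↦ rfl
  -- As `φ` is real, reflecting the test function conjugates its transform.
  have hF : ∀ x, (𝓕 χ' : 𝓢(ℝ, ℂ)) x = conj ((𝓕 χ : 𝓢(ℝ, ℂ)) x) := by
    intro x
    rw [SchwartzMap.fourier_coe, SchwartzMap.fourier_coe, Real.fourier_real_eq,
      Real.fourier_real_eq, ← integral_conj, ← integral_neg_eq_self]
    refine integral_congr_ae (ae_of_all _ fun y ↦ ?_)
    simp only [hv, hv', neg_neg, Circle.smul_def, smul_eq_mul, map_mul, Complex.conj_ofReal]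
    rw [← Circle.coe_inv_eq_conj, ← AddChar.map_neg_eq_inv]
    simp
  calc ∫ ξ, φ ξ • fourierL2 η (-ξ) = ∫ ξ, fourierL2 η ξ * χ' ξ := by
        rw [← integral_neg_eq_self]
        refine integral_congr_ae (ae_of_all _ fun y ↦ ?_)
        simp [hv', mul_comm]
    _ = ∫ x, (η x : ℂ) * conj ((𝓕 χ : 𝓢(ℝ, ℂ)) x) := by rw [← fourierL2_pairing]; simp_rw [hF]
    _ = conj (∫ x, (η x : ℂ) * (𝓕 χ : 𝓢(ℝ, ℂ)) x) := by rw [← integral_conj]; simp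
    _ = ∫ ξ, φ ξ • conj (fourierL2 η ξ) := by
        rw [fourierL2_pairing, ← integral_conj]
        refine integral_congr_ae (ae_of_all _ fun y ↦ ?_)
        simp [hv, mul_comm]

theorem conv_eq_convolution (f g : ℝ → ℂ) :
    conv f g = MeasureTheory.convolution f g (ContinuousLinearMap.mul ℂ ℂ) volume := rfl

theorem integrable_conv {f g : ℝ → ℂ} (hf : Integrable f volume) (hg : Integrable g volume) :
    Integrable (conv f g) volume := by
  rw [conv_eq_convolution]
  exact hf.integrable_convolution _ hg

theorem fourierInv_conv {f g : ℝ → ℂ} (hf : Integrable f volume) (hg : Integrable g volume)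
    (x : ℝ) : 𝓕⁻ (conv f g) x = 𝓕⁻ f x * 𝓕⁻ g x := by
  simp_rw [Real.fourierInv_eq_fourier_neg, conv_eq_convolution]
  exact Real.fourier_mul_convolution_eq hf hg _

/-- Multiplication of a Schwartz function by the `n`-th power of the symbol of `-∂ₓ`. -/
def symbolPow (n : ℕ) (χ : 𝓢(ℝ, ℂ)) : 𝓢(ℝ, ℂ) :=
  SchwartzMap.smulLeftCLM ℂ (fun ξ : ℝ ↦ (-Complex.I * (freq ξ : ℂ)) ^ n) χ

theorem symbolPow_apply (n : ℕ) (χ : 𝓢(ℝ, ℂ)) (ξ : ℝ) :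
    symbolPow n χ ξ = (-Complex.I * (freq ξ : ℂ)) ^ n * χ ξ := by
  rw [symbolPow, SchwartzMap.smulLeftCLM_apply_apply, smul_eq_mul]
  unfold freq
  fun_prop

theorem iteratedDeriv_fourier_schwartz (n : ℕ) (χ : 𝓢(ℝ, ℂ)) (x : ℝ) :
    iteratedDeriv n (𝓕 χ : 𝓢(ℝ, ℂ)) x = (𝓕 (symbolPow n χ) : 𝓢(ℝ, ℂ)) x := by
  have hi (k : ℕ) : Integrable (fun x : ℝ ↦ x ^ k • χ x) volume := by
    have := χ.integrable_pow_mul volume k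
    refine (integrable_norm_iff ?_).1 (this.congr (ae_of_all _ fun x ↦ ?_))
    · have := χ.continuous
      exact Continuous.aestronglyMeasurable (by fun_prop)
    · simp
  rw [SchwartzMap.fourier_coe, SchwartzMap.fourier_coe,
    Real.iteratedDeriv_fourier (N := ⊤) (fun k _ ↦ hi k) le_top]
  have he : (fun ξ : ℝ ↦ (-2 * (Real.pi : ℂ) * Complex.I * ξ) ^ n • χ ξ) = symbolPow n χ := by
    funext ξ
    rw [symbolPow_apply, smul_eq_mul, freq]
    push_cast
    ring
  rw [he]

/-- The real part of a Schwartz function. -/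
def schwartzRe (φ : 𝓢(ℝ, ℂ)) : 𝓢(ℝ, ℝ) := SchwartzMap.postcompCLM (𝕜 := ℝ) Complex.reCLM φ

/-- The imaginary part of a Schwartz function. -/
def schwartzIm (φ : 𝓢(ℝ, ℂ)) : 𝓢(ℝ, ℝ) := SchwartzMap.postcompCLM (𝕜 := ℝ) Complex.imCLM φ

theorem iteratedDeriv_postcomp (L : ℂ →L[ℝ] ℝ) (φ : 𝓢(ℝ, ℂ)) (n : ℕ) (x : ℝ) :
    iteratedDeriv n (fun y ↦ L (φ y)) x = L (iteratedDeriv n φ x) := by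
  have hs : ContDiff ℝ n φ := φ.smooth n
  have := L.iteratedFDeriv_comp_left (f := φ) (x := x) hs.contDiffAt le_rfl
  rw [iteratedDeriv_eq_iteratedFDeriv, iteratedDeriv_eq_iteratedFDeriv]
  exact DFunLike.congr_fun this _

theorem iteratedDeriv_schwartzRe (φ : 𝓢(ℝ, ℂ)) (n : ℕ) (x : ℝ) :
    iteratedDeriv n (schwartzRe φ) x = (iteratedDeriv n φ x).re :=
  iteratedDeriv_postcomp Complex.reCLM φ n x

theorem iteratedDeriv_schwartzIm (φ : 𝓢(ℝ, ℂ)) (n : ℕ) (x : ℝ) :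
    iteratedDeriv n (schwartzIm φ) x = (iteratedDeriv n φ x).im :=
  iteratedDeriv_postcomp Complex.imCLM φ n x

/-- The weak equation is tested against real functions only. Splitting into real and imaginary parts
makes complex test functions available, as the Fourier side requires. -/
theorem integral_ofReal_mul_eq {g : ℝ → ℝ} {φ : ℝ → ℂ}
    (h : Integrable (fun x ↦ (g x : ℂ) * φ x) volume) :
    ∫ x, (g x : ℂ) * φ x = ((∫ x, g x * (φ x).re : ℝ) : ℂ) +
      ((∫ x, g x * (φ x).im : ℝ) : ℂ) * Complex.I := by
  have := integral_re_add_im h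
  rw [← this]
  simp

end FourierPairing

/-! ### Fourier form of the weak derivative and of the right-hand side -/

section WeakEquation

open scoped ComplexConjugate

theorem gevreyENorm_two (σ : ℝ) (η : L2) : gevreyENorm σ 2 η =
    eLpNorm (fun ξ ↦ ((Real.exp (σ * |freq ξ|) * bracket ξ ^ 2 : ℝ) : ℂ) * fourierL2 η ξ) 2
      volume := by
  unfold gevreyENorm
  simp only [bracket_sq, freq]
  norm_num

theorem measurable_fourierL2 (η : L2) : Measurable (fourierL2 η) :=
  (Lp.stronglyMeasurable _).measurable

theorem eLpNorm_bracket_eq (η : L2) :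
    eLpNorm (fun ξ ↦ bracket ξ ^ 2 * ‖fourierL2 η ξ‖) 2 volume = gevreyENorm 0 2 η := by
  rw [gevreyENorm_two]
  refine eLpNorm_congr_norm_ae (ae_of_all _ fun ξ ↦ ?_)
  simp

theorem MemGevrey.memLp_bracket {η : L2} (h : MemGevrey 0 2 η) :
    MemLp (fun ξ ↦ bracket ξ ^ 2 * ‖fourierL2 η ξ‖) 2 volume := by
  refine ⟨?_, (eLpNorm_bracket_eq η).trans_lt h⟩
  have := measurable_fourierL2 η
  exact Measurable.aestronglyMeasurable (by fun_prop)

theorem integrable_of_bracket {f : ℝ → ℂ} (hfm : Measurable f)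
    (hf : MemLp (fun ξ ↦ bracket ξ ^ 2 * ‖f ξ‖) 2 volume) : Integrable f volume := by
  refine (integrable_bracket_mul hf).1.mono' hfm.aestronglyMeasurable (ae_of_all _ fun ξ ↦ ?_)
  exact le_mul_of_one_le_left (norm_nonneg _) (one_le_bracket ξ)

theorem integrable_freq_of_bracket {f : ℝ → ℂ} (hfm : Measurable f)
    (hf : MemLp (fun ξ ↦ bracket ξ ^ 2 * ‖f ξ‖) 2 volume) :
    Integrable (fun ξ ↦ (freq ξ : ℂ) * f ξ) volume := by
  refine (integrable_bracket_mul hf).1.mono' (Measurable.aestronglyMeasurable (by fun_prop))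
    (ae_of_all _ fun ξ ↦ ?_)
  rw [norm_mul, Complex.norm_real]
  exact mul_le_mul_of_nonneg_right (abs_le_japanese _) (norm_nonneg _)

theorem memLp_ofReal (η : L2) : MemLp (fun x ↦ (η x : ℂ)) 2 volume :=
  (Lp.memLp η).ofReal

theorem integral_ofReal_mul_deriv {η ηx : L2} (h : HasWeakDeriv η ηx) (φ : 𝓢(ℝ, ℂ)) :
    ∫ x, (η x : ℂ) * iteratedDeriv 1 φ x = -∫ x, (ηx x : ℂ) * φ x := by
  have h1 : ∀ x, iteratedDeriv 1 φ x = SchwartzMap.derivCLM ℝ ℂ φ x := fun x ↦ by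
    rw [iteratedDeriv_one, SchwartzMap.derivCLM_apply]
  have hi : Integrable (fun x ↦ (η x : ℂ) * iteratedDeriv 1 φ x) volume := by
    simp_rw [h1]
    exact integrable_mul_schwartz_of_memLp (memLp_ofReal η) _
  rw [integral_ofReal_mul_eq hi,
    integral_ofReal_mul_eq (integrable_mul_schwartz_of_memLp (memLp_ofReal ηx) φ)]
  have hr := h (schwartzRe φ)
  have hm := h (schwartzIm φ)
  simp only [← iteratedDeriv_one, iteratedDeriv_schwartzRe, iteratedDeriv_schwartzIm] at hr hm
  rw [hr, hm]
  change _ = -(((∫ x, ηx x * schwartzRe φ x : ℝ) : ℂ) +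
    ((∫ x, ηx x * schwartzIm φ x : ℝ) : ℂ) * Complex.I)
  push_cast
  ring

/-- Pins down the weak derivative that `IsGlobalSolution` only asserts to exist, so that the
transform of its square is a convolution. -/
theorem ae_eq_fourierInv_deriv {η ηx : L2} (h : HasWeakDeriv η ηx)
    (hf : Integrable (fun ξ ↦ (freq ξ : ℂ) * fourierL2 η ξ) volume) :
    ∀ᵐ x, (ηx x : ℂ) = 𝓕⁻ (fun ξ ↦ Complex.I * ((freq ξ : ℂ) * fourierL2 η ξ)) x := by
  have hf' := hf.const_mul Complex.I
  refine ae_eq_of_fourier_pairing_eq (locallyIntegrable_ofReal ηx)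
    (continuous_fourierInv hf').locallyIntegrable fun χ ↦ ?_
  rw [integral_fourierInv_mul_fourier hf', ← neg_eq_iff_eq_neg.2 (integral_ofReal_mul_deriv h _)]
  simp_rw [iteratedDeriv_fourier_schwartz]
  rw [fourierL2_pairing, ← integral_neg]
  refine integral_congr_ae (ae_of_all _ fun ξ ↦ ?_)
  simp only [symbolPow_apply]
  ring

/-- The right-hand side of the equation on the Fourier side. -/
def rhsHat (γ₂ δ₂ : ℝ) (f : ℝ → ℂ) (ξ : ℝ) : ℂ :=
  -Complex.I * ((freq ξ * (1 - γ₂ * freq ξ ^ 2 + δ₂ * freq ξ ^ 4) : ℝ) : ℂ) * f ξ + nonlinHat f ξ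

/-- The symbol of `1 - γ₁ ∂ₓ² + δ₁ ∂ₓ⁴`. -/
def energySymbol (γ₁ δ₁ ξ : ℝ) : ℝ := 1 + γ₁ * freq ξ ^ 2 + δ₁ * freq ξ ^ 4

theorem integral_rhsHat_mul {γ₂ δ₂ : ℝ} {f : ℝ → ℂ} (hfi : Integrable f volume)
    (hκi : Integrable (fun ξ ↦ (freq ξ : ℂ) * f ξ) volume) (χ : 𝓢(ℝ, ℂ)) :
    ∫ ξ, rhsHat γ₂ δ₂ f ξ * χ ξ =
      (∫ ξ, f ξ * (symbolPow 1 χ + (γ₂ : ℂ) • symbolPow 3 χ + (δ₂ : ℂ) • symbolPow 5 χ) ξ)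
      + 3 / 4 * (∫ ξ, conv f f ξ * symbolPow 1 χ ξ)
      + 7 / 48 * (∫ ξ, conv f f ξ * symbolPow 3 χ ξ)
      + 7 / 48 * (∫ ξ, conv (fun s ↦ freq s * f s) (fun s ↦ freq s * f s) ξ * symbolPow 1 χ ξ)
      - 1 / 8 * (∫ ξ, conv f (conv f f) ξ * symbolPow 1 χ ξ) := by
  have c2 := integrable_conv hfi hfi
  have cκ := integrable_conv hκi hκi
  have c3 := integrable_conv hfi c2
  have j1 := integrable_mul_schwartz hfi
    (symbolPow 1 χ + (γ₂ : ℂ) • symbolPow 3 χ + (δ₂ : ℂ) • symbolPow 5 χ)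
  have j2 := (integrable_mul_schwartz c2 (symbolPow 1 χ)).const_mul (3 / 4 : ℂ)
  have j3 := (integrable_mul_schwartz c2 (symbolPow 3 χ)).const_mul (7 / 48 : ℂ)
  have j4 := (integrable_mul_schwartz cκ (symbolPow 1 χ)).const_mul (7 / 48 : ℂ)
  have j5 := (integrable_mul_schwartz c3 (symbolPow 1 χ)).const_mul (1 / 8 : ℂ)
  rw [← integral_const_mul, ← integral_const_mul, ← integral_const_mul, ← integral_const_mul,
    ← integral_add j1 j2, ← integral_add (by exact j1.add j2) j3,
    ← integral_add (by exact (j1.add j2).add j3) j4,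
    ← integral_sub (by exact ((j1.add j2).add j3).add j4) j5]
  refine integral_congr_ae (ae_of_all _ fun ξ ↦ ?_)
  simp only [rhsHat, nonlinHat, add_apply, smul_apply, symbolPow_apply,
    smul_eq_mul]
  have hI : Complex.I ^ 2 = -1 := Complex.I_sq
  have hI3 : Complex.I ^ 3 = -Complex.I := by rw [pow_succ, hI]; ring
  have hI5 : Complex.I ^ 5 = Complex.I := by
    rw [show Complex.I ^ 5 = (Complex.I ^ 2) ^ 2 * Complex.I by ring, hI]; ring
  push_cast
  ring_nf
  rw [hI3, hI5]
  ring

end WeakEquation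

/-! ### The equation on the Fourier side -/

section FourierEquation

theorem integrable_ofReal_mul_schwartz {g : ℝ → ℝ} (hg : Integrable g volume) (φ : 𝓢(ℝ, ℂ)) :
    Integrable (fun x ↦ (g x : ℂ) * φ x) volume :=
  integrable_mul_schwartz hg.ofReal φ

/-- The pairing of `1 - γ₁ ∂ₓ² + δ₁ ∂ₓ⁴` applied to `η` with a test function, on the Fourier
side. -/
theorem integral_mul_energySymbol (γ₁ δ₁ : ℝ) (η : L2) (χ : 𝓢(ℝ, ℂ)) :
    ((∫ x, η x * (schwartzRe (𝓕 χ) x - γ₁ * iteratedDeriv 2 (schwartzRe (𝓕 χ)) x +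
        δ₁ * iteratedDeriv 4 (schwartzRe (𝓕 χ)) x) : ℝ) : ℂ) +
      ((∫ x, η x * (schwartzIm (𝓕 χ) x - γ₁ * iteratedDeriv 2 (schwartzIm (𝓕 χ)) x +
        δ₁ * iteratedDeriv 4 (schwartzIm (𝓕 χ)) x) : ℝ) : ℂ) * Complex.I =
    ∫ ξ, fourierL2 η ξ * (energySymbol γ₁ δ₁ ξ * χ ξ) := by
  set Ψ : 𝓢(ℝ, ℂ) := χ + (-γ₁ : ℂ) • symbolPow 2 χ + (δ₁ : ℂ) • symbolPow 4 χ with hΨ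
  have hF : ∀ x, (𝓕 Ψ : 𝓢(ℝ, ℂ)) x = (𝓕 χ : 𝓢(ℝ, ℂ)) x -
      γ₁ * iteratedDeriv 2 (𝓕 χ : 𝓢(ℝ, ℂ)) x + δ₁ * iteratedDeriv 4 (𝓕 χ : 𝓢(ℝ, ℂ)) x := by
    intro x
    simp only [iteratedDeriv_fourier_schwartz, hΨ, FourierTransform.fourier_add,
      FourierTransform.fourier_smul, add_apply, smul_apply, smul_eq_mul]
    ring
  have h1 := integral_ofReal_mul_eq (integrable_mul_schwartz_of_memLp (memLp_ofReal η) (𝓕 Ψ))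
  have h2 := fourierL2_pairing η Ψ
  simp only [iteratedDeriv_schwartzRe, iteratedDeriv_schwartzIm]
  calc _ = ∫ x, (η x : ℂ) * (𝓕 Ψ : 𝓢(ℝ, ℂ)) x := by
        rw [h1]
        congr! 5 with x x
        · rw [hF]; simp; rfl
        · rw [hF]; simp; exact Or.inl rfl
    _ = _ := by
        rw [h2]
        refine integral_congr_ae (ae_of_all _ fun ξ ↦ ?_)
        simp only [hΨ, add_apply, smul_apply, smul_eq_mul, symbolPow_apply, energySymbol]
        have hI : Complex.I ^ 2 = -1 := Complex.I_sq
        have hI4 : Complex.I ^ 4 = 1 := Complex.I_pow_four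
        push_cast
        ring_nf
        rw [hI, hI4]
        ring

/-- Used with `g` equal to η², ηₓ² or η³ and `F` the corresponding convolution: derivatives of the
test function become powers of the symbol. -/
theorem complex_pairing {g : ℝ → ℝ} {F : ℝ → ℂ} (hg : Integrable g volume)
    (hF : Integrable F volume) (h : ∀ᵐ x, (g x : ℂ) = 𝓕⁻ F x) (n : ℕ) (χ : 𝓢(ℝ, ℂ)) :
    ((∫ x, g x * iteratedDeriv n (schwartzRe (𝓕 χ)) x : ℝ) : ℂ) +
      ((∫ x, g x * iteratedDeriv n (schwartzIm (𝓕 χ)) x : ℝ) : ℂ) * Complex.I =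
    ∫ ξ, F ξ * symbolPow n χ ξ := by
  simp only [iteratedDeriv_schwartzRe, iteratedDeriv_schwartzIm, iteratedDeriv_fourier_schwartz]
  rw [← integral_ofReal_mul_eq (integrable_ofReal_mul_schwartz hg _),
    ← integral_fourierInv_mul_fourier hF]
  refine integral_congr_ae ?_
  filter_upwards [h] with x hx
  rw [hx]

theorem complex_pairing_linear (γ₂ δ₂ : ℝ) (η : L2) (χ : 𝓢(ℝ, ℂ)) :
    ((∫ x, η x * (iteratedDeriv 1 (schwartzRe (𝓕 χ)) x +
        γ₂ * iteratedDeriv 3 (schwartzRe (𝓕 χ)) x +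
        δ₂ * iteratedDeriv 5 (schwartzRe (𝓕 χ)) x) : ℝ) : ℂ) +
      ((∫ x, η x * (iteratedDeriv 1 (schwartzIm (𝓕 χ)) x +
        γ₂ * iteratedDeriv 3 (schwartzIm (𝓕 χ)) x +
        δ₂ * iteratedDeriv 5 (schwartzIm (𝓕 χ)) x) : ℝ) : ℂ) * Complex.I =
    ∫ ξ, fourierL2 η ξ *
      (symbolPow 1 χ + (γ₂ : ℂ) • symbolPow 3 χ + (δ₂ : ℂ) • symbolPow 5 χ) ξ := by
  set Ψ : 𝓢(ℝ, ℂ) := symbolPow 1 χ + (γ₂ : ℂ) • symbolPow 3 χ + (δ₂ : ℂ) • symbolPow 5 χ with hΨ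
  have hF : ∀ x, (𝓕 Ψ : 𝓢(ℝ, ℂ)) x = iteratedDeriv 1 (𝓕 χ : 𝓢(ℝ, ℂ)) x +
      γ₂ * iteratedDeriv 3 (𝓕 χ : 𝓢(ℝ, ℂ)) x + δ₂ * iteratedDeriv 5 (𝓕 χ : 𝓢(ℝ, ℂ)) x := by
    intro x
    simp only [iteratedDeriv_fourier_schwartz, hΨ, FourierTransform.fourier_add,
      FourierTransform.fourier_smul]
    rfl
  have h1 := integral_ofReal_mul_eq (integrable_mul_schwartz_of_memLp (memLp_ofReal η) (𝓕 Ψ))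
  have h2 := fourierL2_pairing η Ψ
  simp only [iteratedDeriv_schwartzRe, iteratedDeriv_schwartzIm]
  rw [← h2, h1]
  congr! 5 with x x
  · rw [hF]; simp
  · rw [hF]; simp

/-- The equation on the Fourier side, tested against Schwartz functions. -/
theorem IsGlobalSolution.hasDerivWithinAt_fourier {γ₁ γ₂ δ₁ δ₂ : ℝ} {η₀ : L2} {η : ℝ → L2}
    (h : IsGlobalSolution γ₁ γ₂ δ₁ δ₂ (7 / 48) η₀ η) (χ : 𝓢(ℝ, ℂ)) {t : ℝ} (ht : 0 ≤ t) :
    HasDerivWithinAt (fun τ ↦ ∫ ξ, fourierL2 (η τ) ξ * (energySymbol γ₁ δ₁ ξ * χ ξ))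
      (∫ ξ, rhsHat γ₂ δ₂ (fourierL2 (η t)) ξ * χ ξ) (Ici 0) t := by
  obtain ⟨ηx, hηx, heq⟩ := h.equation
  have hL2 := (h.mem_sobolev t ht).memLp_bracket
  have hfm := measurable_fourierL2 (η t)
  set f := (fourierL2 (η t) : ℝ → ℂ) with hf
  have hfi := integrable_of_bracket hfm hL2
  have hκi := integrable_freq_of_bracket hfm hL2
  have c2 := integrable_conv hfi hfi
  have cκ := integrable_conv (hκi.const_mul Complex.I) (hκi.const_mul Complex.I)
  have c3 := integrable_conv hfi c2
  have hη := ae_eq_fourierInv (η t) hfi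
  have hηx' := ae_eq_fourierInv_deriv (hηx t ht) hκi
  have i2 : Integrable (fun x ↦ (η t x) ^ 2) volume := (Lp.memLp (η t)).integrable_sq
  have ix : Integrable (fun x ↦ (ηx t x) ^ 2) volume := (Lp.memLp (ηx t)).integrable_sq
  -- η is bounded, having an integrable transform, and η² is integrable.
  have i3 : Integrable (fun x ↦ (η t x) ^ 3) volume := by
    have : Integrable (fun x ↦ (η t x) * (η t x) ^ 2) volume := by
      refine i2.bdd_mul (c := ∫ ξ, ‖f ξ‖) (Lp.aestronglyMeasurable _) ?_
      filter_upwards [hη] with x hx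
      rw [← Complex.norm_real, hx]
      exact norm_fourierInv_le x
    exact this.congr (ae_of_all _ fun x ↦ by ring)
  have r2 : ∀ᵐ x, (((η t x) ^ 2 : ℝ) : ℂ) = 𝓕⁻ (conv f f) x := by
    filter_upwards [hη] with x hx
    rw [fourierInv_conv hfi hfi, ← hx]; push_cast; ring
  have r3 : ∀ᵐ x, (((η t x) ^ 3 : ℝ) : ℂ) = 𝓕⁻ (conv f (conv f f)) x := by
    filter_upwards [hη] with x hx
    rw [fourierInv_conv hfi c2, fourierInv_conv hfi hfi, ← hx]; push_cast; ring
  have rx : ∀ᵐ x, (((ηx t x) ^ 2 : ℝ) : ℂ) = 𝓕⁻ (conv (fun ξ ↦ Complex.I * ((freq ξ : ℂ) * f ξ))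
      (fun ξ ↦ Complex.I * ((freq ξ : ℂ) * f ξ))) x := by
    filter_upwards [hηx'] with x hx
    rw [fourierInv_conv (hκi.const_mul _) (hκi.const_mul _), ← hx]; push_cast; ring
  have hre := (heq (schwartzRe (𝓕 χ)) t ht).ofReal_comp
  have him := ((heq (schwartzIm (𝓕 χ)) t ht).ofReal_comp).mul_const Complex.I
  have hsum := hre.add him
  have hfun : (fun τ ↦ ∫ ξ, fourierL2 (η τ) ξ * (energySymbol γ₁ δ₁ ξ * χ ξ)) = fun τ ↦ _ :=
    funext fun τ ↦ (integral_mul_energySymbol γ₁ δ₁ (η τ) χ).symm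
  rw [hfun]
  refine hsum.congr_deriv ?_
  -- The two factors i from ηₓ give the minus sign in front of the convolution in `nonlinHat`.
  have hcκ : ∀ ξ, conv (fun ξ ↦ Complex.I * ((freq ξ : ℂ) * f ξ))
      (fun ξ ↦ Complex.I * ((freq ξ : ℂ) * f ξ)) ξ =
      -conv (fun s ↦ freq s * f s) (fun s ↦ freq s * f s) ξ := fun ξ ↦ by
    unfold conv
    rw [← integral_neg]
    refine integral_congr_ae (ae_of_all _ fun s ↦ ?_)
    linear_combination (freq s * f s * (freq (ξ - s) * f (ξ - s))) * Complex.I_sq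
  have q0 := complex_pairing_linear γ₂ δ₂ (η t) χ
  have q1 := complex_pairing i2 c2 r2 1 χ
  have q2 := complex_pairing i2 c2 r2 3 χ
  have q3 := complex_pairing ix cκ rx 1 χ
  have q4 := complex_pairing i3 c3 r3 1 χ
  simp_rw [hcκ, neg_mul] at q3
  rw [integral_neg] at q3
  rw [integral_rhsHat_mul hfi hκi, ← hf] at *
  rw [← q0, ← q1, ← q2, ← q4, ← neg_eq_iff_eq_neg.2 q3]
  simp only [iteratedDeriv_one]
  push_cast
  ring

end FourierEquation

/-! ### Local Lipschitz bound for the nonlinearity -/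

section NonlinearContinuity

theorem measurable_conv {f g : ℝ → ℂ} (hf : Measurable f) (hg : Measurable g) :
    Measurable (conv f g) := by
  have : StronglyMeasurable (fun x : ℝ × ℝ ↦ f x.2 * g (x.1 - x.2)) :=
    Measurable.stronglyMeasurable (by fun_prop)
  exact this.integral_prod_right'.measurable

theorem measurable_nonlinHat {f : ℝ → ℂ} (hf : Measurable f) : Measurable (nonlinHat f) := by
  have h1 := measurable_conv hf hf
  have h2 := measurable_conv hf h1
  have h3 := measurable_conv (f := fun s ↦ (freq s : ℂ) * f s) (g := fun s ↦ (freq s : ℂ) * f s)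
    (by fun_prop) (by fun_prop)
  unfold nonlinHat
  fun_prop

/-- The norm of the Sobolev space `H²` on the Fourier side. -/
def sobolevNorm (f : ℝ → ℂ) : ℝ := l2norm fun ξ ↦ bracket ξ ^ 2 * ‖f ξ‖

/-- Measurability and membership in the Sobolev space `H²` on the Fourier side. -/
structure MemSobolev (f : ℝ → ℂ) : Prop where
  measurable : Measurable f
  memLp : MemLp (fun ξ ↦ bracket ξ ^ 2 * ‖f ξ‖) 2 volume

theorem sobolevNorm_nonneg (f : ℝ → ℂ) : 0 ≤ sobolevNorm f := l2norm_nonneg _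

theorem MemSobolev.sub {f g : ℝ → ℂ} (hf : MemSobolev f) (hg : MemSobolev g) :
    MemSobolev (f - g) := by
  have hm := hf.measurable.sub hg.measurable
  refine ⟨hm, (hf.memLp.add hg.memLp).mono (Measurable.aestronglyMeasurable (by fun_prop))
    (ae_of_all _ fun ξ ↦ ?_)⟩
  have hb := pow_pos (bracket_pos ξ) 2
  simp only [Pi.add_apply, Pi.sub_apply]
  rw [← mul_add, norm_mul, norm_mul, norm_norm]
  gcongr
  exact (norm_sub_le _ _).trans (Real.le_norm_self _)

theorem MemSobolev.memLp_self {f : ℝ → ℂ} (hf : MemSobolev f) : MemLp f 2 volume :=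
  memLp_self_of_bracket hf.measurable hf.memLp

theorem MemSobolev.memLp_freq {f : ℝ → ℂ} (hf : MemSobolev f) :
    MemLp (fun ξ ↦ (freq ξ : ℂ) * f ξ) 2 volume :=
  memLp_freq_of_bracket hf.measurable hf.memLp

theorem MemSobolev.integrable {f : ℝ → ℂ} (hf : MemSobolev f) : Integrable f volume :=
  integrable_of_bracket hf.measurable hf.memLp

theorem MemSobolev.l2norm_le {f : ℝ → ℂ} (hf : MemSobolev f) : l2norm f ≤ sobolevNorm f := by
  refine ENNReal.toReal_mono hf.memLp.2.ne (eLpNorm_mono fun ξ ↦ ?_)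
  rw [norm_mul, norm_norm]
  refine le_mul_of_one_le_left (norm_nonneg _) ?_
  exact (one_le_pow₀ (one_le_bracket ξ)).trans (Real.le_norm_self _)

theorem MemSobolev.l2norm_freq_le {f : ℝ → ℂ} (hf : MemSobolev f) :
    l2norm (fun ξ ↦ (freq ξ : ℂ) * f ξ) ≤ sobolevNorm f := by
  refine ENNReal.toReal_mono hf.memLp.2.ne (eLpNorm_mono fun ξ ↦ ?_)
  rw [norm_mul, norm_mul, norm_norm, Complex.norm_real]
  exact mul_le_mul_of_nonneg_right ((abs_freq_le_bracket_sq ξ).trans (Real.le_norm_self _))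
    (norm_nonneg _)

theorem MemSobolev.integral_norm_le {f : ℝ → ℂ} (hf : MemSobolev f) :
    ∫ ξ, ‖f ξ‖ ≤ bracketConst * sobolevNorm f := by
  obtain ⟨h1, h2⟩ := integrable_bracket_mul hf.memLp
  refine (integral_mono hf.integrable.norm h1.norm fun ξ ↦ ?_).trans h2
  rw [norm_mul, norm_norm, Real.norm_of_nonneg (bracket_pos ξ).le]
  exact le_mul_of_one_le_left (norm_nonneg _) (one_le_bracket ξ)

theorem memLp_comp_sub_left {g : ℝ → ℂ} (hg : MemLp g 2 volume) (ξ : ℝ) :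
    MemLp (fun s ↦ g (ξ - s)) 2 volume := by
  simpa [sub_eq_add_neg, add_comm] using memLp_comp_neg_add hg (-ξ)

theorem norm_conv_le {f g : ℝ → ℂ} (hf : MemLp f 2 volume) (hg : MemLp g 2 volume) (ξ : ℝ) :
    ‖conv f g ξ‖ ≤ l2norm f * l2norm g := by
  have h1 : l2norm (fun s ↦ g (ξ - s)) = l2norm g := by
    simpa [sub_eq_add_neg, add_comm] using l2norm_comp_neg_add hg.1 (-ξ)
  rw [← h1]
  exact (norm_integral_le_integral_norm _).trans (integral_norm_mul_le hf (memLp_comp_sub_left hg ξ))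

theorem norm_conv_sub_conv_le {f g f₀ g₀ : ℝ → ℂ} (hf : MemLp f 2 volume) (hg : MemLp g 2 volume)
    (hf₀ : MemLp f₀ 2 volume) (hg₀ : MemLp g₀ 2 volume) (ξ : ℝ) :
    ‖conv f g ξ - conv f₀ g₀ ξ‖ ≤
      l2norm (f - f₀) * l2norm g + l2norm f₀ * l2norm (g - g₀) := by
  have e : conv f g ξ - conv f₀ g₀ ξ = conv (f - f₀) g ξ + conv f₀ (g - g₀) ξ := by
    unfold conv
    have i1 := hf.integrable_mul (memLp_comp_sub_left hg ξ)
    have i2 := hf₀.integrable_mul (memLp_comp_sub_left hg₀ ξ)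
    have i3 := (hf.sub hf₀).integrable_mul (memLp_comp_sub_left hg ξ)
    have i4 := hf₀.integrable_mul (memLp_comp_sub_left (hg.sub hg₀) ξ)
    rw [← integral_sub (by exact i1) (by exact i2), ← integral_add (by exact i3) (by exact i4)]
    refine integral_congr_ae (ae_of_all _ fun s ↦ ?_)
    simp only [Pi.sub_apply]
    ring
  rw [e]
  exact (norm_add_le _ _).trans (add_le_add (norm_conv_le (hf.sub hf₀) hg ξ)
    (norm_conv_le hf₀ (hg.sub hg₀) ξ))

theorem norm_conv_le_of_bounded {f k : ℝ → ℂ} (hf : Integrable f volume) {K : ℝ}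
    (hK : ∀ x, ‖k x‖ ≤ K) (ξ : ℝ) : ‖conv f k ξ‖ ≤ (∫ s, ‖f s‖) * K := by
  rw [← integral_mul_const]
  refine norm_integral_le_of_norm_le (hf.norm.mul_const K) (ae_of_all _ fun s ↦ ?_)
  rw [norm_mul]
  exact mul_le_mul_of_nonneg_left (hK _) (norm_nonneg _)

theorem norm_conv_sub_conv_le_of_bounded {f k f₀ k₀ : ℝ → ℂ} (hf : Integrable f volume)
    (hf₀ : Integrable f₀ volume) (hkm : Measurable k) (hk₀m : Measurable k₀) {K K₀ L : ℝ}
    (hK : ∀ x, ‖k x‖ ≤ K) (hK₀ : ∀ x, ‖k₀ x‖ ≤ K₀) (hL : ∀ x, ‖k x - k₀ x‖ ≤ L) (ξ : ℝ) :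
    ‖conv f k ξ - conv f₀ k₀ ξ‖ ≤ (∫ s, ‖(f - f₀) s‖) * K + (∫ s, ‖f₀ s‖) * L := by
  have hi {g h : ℝ → ℂ} {C : ℝ} (hg : Integrable g volume) (hh : Measurable h)
      (hC : ∀ x, ‖h x‖ ≤ C) : Integrable (fun s ↦ g s * h (ξ - s)) volume :=
    hg.mul_bdd (Measurable.aestronglyMeasurable (by fun_prop)) (ae_of_all _ fun s ↦ hC _)
  have e : conv f k ξ - conv f₀ k₀ ξ = conv (f - f₀) k ξ + conv f₀ (k - k₀) ξ := by
    unfold conv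
    rw [← integral_sub (hi hf hkm hK) (hi hf₀ hk₀m hK₀),
      ← integral_add (hi (hf.sub hf₀) hkm hK) (hi hf₀ (hkm.sub hk₀m) hL)]
    refine integral_congr_ae (ae_of_all _ fun s ↦ ?_)
    simp only [Pi.sub_apply]
    ring
  rw [e]
  exact (norm_add_le _ _).trans (add_le_add (norm_conv_le_of_bounded (hf.sub hf₀) hK ξ)
    (norm_conv_le_of_bounded hf₀ hL ξ))

/-- The nonlinearity is locally Lipschitz continuous on `H²`, locally uniformly in the frequency. -/
theorem norm_nonlinHat_sub_le {f f₀ : ℝ → ℂ} (hf : MemSobolev f) (hf₀ : MemSobolev f₀) (ξ : ℝ)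
    {a a₀ d : ℝ} (ha : sobolevNorm f = a) (ha₀ : sobolevNorm f₀ = a₀)
    (hd : sobolevNorm (f - f₀) = d) :
    ‖nonlinHat f ξ - nonlinHat f₀ ξ‖ ≤ |freq ξ| * (1 + |freq ξ| ^ 2) *
      (d * ((a + a₀) + bracketConst * (a * a + a₀ * (a + a₀)))) := by
  have hs := hf.sub hf₀
  have a0 : 0 ≤ a := ha ▸ sobolevNorm_nonneg f
  have a₀0 : 0 ≤ a₀ := ha₀ ▸ sobolevNorm_nonneg f₀
  have d0 : 0 ≤ d := hd ▸ sobolevNorm_nonneg _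
  have b0 := bracketConst_nonneg
  have l1 := hf.l2norm_le
  have l2 := hf₀.l2norm_le
  have l3 := hs.l2norm_le
  have m1 := hf.l2norm_freq_le
  have m2 := hf₀.l2norm_freq_le
  have m3 := hs.l2norm_freq_le
  have p1 := hf.integral_norm_le
  have p2 := hf₀.integral_norm_le
  have p3 := hs.integral_norm_le
  rw [ha] at l1 m1 p1
  rw [ha₀] at l2 m2 p2
  rw [hd] at l3 m3 p3
  have c1 : ∀ x, ‖conv f f x - conv f₀ f₀ x‖ ≤ d * (a + a₀) := fun x ↦ by
    refine (norm_conv_sub_conv_le hf.memLp_self hf.memLp_self hf₀.memLp_self hf₀.memLp_self x).trans ?_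
    calc _ ≤ d * a + a₀ * d := by
          gcongr <;> exact l2norm_nonneg _
      _ = _ := by ring
  have c2 : ‖conv (fun s ↦ freq s * f s) (fun s ↦ freq s * f s) ξ -
      conv (fun s ↦ freq s * f₀ s) (fun s ↦ freq s * f₀ s) ξ‖ ≤ d * (a + a₀) := by
    refine (norm_conv_sub_conv_le hf.memLp_freq hf.memLp_freq hf₀.memLp_freq hf₀.memLp_freq ξ).trans ?_
    have he : ((fun s ↦ (freq s : ℂ) * f s) - fun s ↦ (freq s : ℂ) * f₀ s) =
      fun s ↦ (freq s : ℂ) * (f - f₀) s := by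
      ext s; simp only [Pi.sub_apply]; ring
    rw [he]
    calc _ ≤ d * a + a₀ * d := by
          gcongr <;> exact l2norm_nonneg _
      _ = _ := by ring
  have k1 : ∀ x, ‖conv f f x‖ ≤ a * a := fun x ↦
    (norm_conv_le hf.memLp_self hf.memLp_self x).trans (by gcongr; exact l2norm_nonneg _)
  have k2 : ∀ x, ‖conv f₀ f₀ x‖ ≤ a₀ * a₀ := fun x ↦
    (norm_conv_le hf₀.memLp_self hf₀.memLp_self x).trans (by gcongr; exact l2norm_nonneg _)
  -- The inner convolution is controlled in the sup norm, so the outer one is estimated by L¹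
  -- against L^∞.
  have c3 : ‖conv f (conv f f) ξ - conv f₀ (conv f₀ f₀) ξ‖ ≤
      d * (bracketConst * (a * a + a₀ * (a + a₀))) := by
    refine (norm_conv_sub_conv_le_of_bounded hf.integrable hf₀.integrable
      (measurable_conv hf.measurable hf.measurable)
      (measurable_conv hf₀.measurable hf₀.measurable) k1 k2 c1 ξ).trans ?_
    calc _ ≤ bracketConst * d * (a * a) + bracketConst * a₀ * (d * (a + a₀)) := by gcongr
      _ = _ := by ring
  have e : nonlinHat f ξ - nonlinHat f₀ ξ =
      -Complex.I * freq ξ * (3 / 4 - 7 / 48 * (freq ξ : ℂ) ^ 2) * (conv f f ξ - conv f₀ f₀ ξ)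
      - Complex.I * freq ξ * (7 / 48) * (conv (fun s ↦ freq s * f s) (fun s ↦ freq s * f s) ξ -
        conv (fun s ↦ freq s * f₀ s) (fun s ↦ freq s * f₀ s) ξ)
      + Complex.I * freq ξ * (1 / 8) * (conv f (conv f f) ξ - conv f₀ (conv f₀ f₀) ξ) := by
    unfold nonlinHat; ring
  have n1 : ‖(3 / 4 - 7 / 48 * (freq ξ : ℂ) ^ 2)‖ ≤ 3 / 4 + 7 / 48 * |freq ξ| ^ 2 := by
    refine (norm_sub_le _ _).trans ?_
    simp
  rw [e]
  refine (norm_add_le _ _).trans ((add_le_add_left (norm_sub_le _ _) _).trans ?_)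
  simp only [norm_mul, norm_neg, Complex.norm_I, Complex.norm_real, Real.norm_eq_abs, one_mul]
  norm_num only [norm_div, norm_one, RCLike.norm_ofNat]
  have x0 := abs_nonneg (freq ξ)
  generalize |freq ξ| = x at *
  have hA : 0 ≤ d * (a + a₀) := by positivity
  have hB : 0 ≤ d * (bracketConst * (a * a + a₀ * (a + a₀))) := by positivity
  calc _ ≤ x * (3 / 4 + 7 / 48 * x ^ 2) * (d * (a + a₀)) + x * (7 / 48) * (d * (a + a₀)) +
        x * (1 / 8) * (d * (bracketConst * (a * a + a₀ * (a + a₀)))) := by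
        gcongr
        · exact c1 ξ
    _ ≤ x * (1 + x ^ 2) * (d * (a + a₀)) +
        x * (1 + x ^ 2) * (d * (bracketConst * (a * a + a₀ * (a + a₀)))) := by
        have q1 : x * (3 / 4 + 7 / 48 * x ^ 2) + x * (7 / 48) ≤ x * (1 + x ^ 2) := by nlinarith [sq_nonneg x]
        have q2 : x * (1 / 8) ≤ x * (1 + x ^ 2) := by nlinarith [sq_nonneg x]
        rw [← add_mul]
        gcongr
    _ = _ := by ring

end NonlinearContinuity

/-! ### Multipliers on a bounded frequency band -/

section Cutoff

/-- Complex-valued square-integrable functions on the frequency line. -/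
abbrev L2C : Type := Lp ℂ 2 (volume : Measure ℝ)

/-- On a bounded band the unbounded symbols of the equation become bounded multipliers on L². -/
theorem memLp_top_cutoff {a : ℝ → ℂ} (ha : Continuous a) (R : ℝ) :
    MemLp (indicator (Ioo (-R) R) a) ∞ volume := by
  obtain ⟨C, hC⟩ := isCompact_Icc.exists_bound_of_continuousOn (s := Icc (-R) R) ha.continuousOn
  refine memLp_top_of_bound (ha.aestronglyMeasurable.indicator measurableSet_Ioo) (max C 0)
    (ae_of_all _ fun ξ ↦ ?_)
  by_cases h : ξ ∈ Ioo (-R) R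
  · rw [indicator_of_mem h]
    exact (hC ξ (Ioo_subset_Icc_self h)).trans (le_max_left _ _)
  · rw [indicator_of_notMem h, norm_zero]
    exact le_max_right _ _

/-- Multiplication by a continuous function truncated to `(-R, R)`. -/
def cutoffMul {a : ℝ → ℂ} (ha : Continuous a) (R : ℝ) : L2C →L[ℂ] L2C :=
  (ContinuousLinearMap.mul ℂ ℂ).holderL volume ∞ 2 2 ((memLp_top_cutoff ha R).toLp _)

theorem cutoffMul_coeFn {a : ℝ → ℂ} (ha : Continuous a) (R : ℝ) (f : L2C) :
    ∀ᵐ ξ, cutoffMul ha R f ξ = indicator (Ioo (-R) R) a ξ * f ξ := by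
  filter_upwards [(ContinuousLinearMap.mul ℂ ℂ).coeFn_holder (r := 2)
    ((memLp_top_cutoff ha R).toLp _) f, (memLp_top_cutoff ha R).coeFn_toLp] with ξ h1 h2
  refine h1.trans ?_
  rw [h2]
  rfl

theorem memLp_cutoff_of_bound {g : ℝ → ℂ} (hg : Measurable g) {R K : ℝ}
    (hK : ∀ ξ ∈ Ioo (-R) R, ‖g ξ‖ ≤ K) : MemLp (indicator (Ioo (-R) R) g) 2 volume := by
  rw [memLp_indicator_iff_restrict measurableSet_Ioo]
  exact MemLp.of_bound hg.aestronglyMeasurable K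
    ((ae_restrict_iff' measurableSet_Ioo).2 (ae_of_all _ hK))

/-- The pairing with a Schwartz function, as a continuous linear functional. -/
def pairingCLM (χ : 𝓢(ℝ, ℂ)) : L2C →L[ℂ] ℂ :=
  innerSL ℂ (((χ.memLp 2).star).toLp (star ⇑χ) : L2C)

theorem pairingCLM_apply (χ : 𝓢(ℝ, ℂ)) (f : L2C) : pairingCLM χ f = ∫ ξ, f ξ * χ ξ := by
  rw [pairingCLM, innerSL_apply_apply, L2.inner_def]
  refine integral_congr_ae ?_
  filter_upwards [((χ.memLp 2).star).coeFn_toLp] with ξ h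
  rw [h]
  simp

end Cutoff

/-! ### Time continuity of the solution and of the truncated nonlinearity -/

section Regularity

variable {γ₁ γ₂ δ₁ δ₂ : ℝ} {η₀ : L2} {η : ℝ → L2}

/-- The Fourier transform of a solution, extended to negative times as a constant. -/
def solHat (η : ℝ → L2) (t : ℝ) : L2C := fourierL2 (η (max t 0))

theorem fourierL2_sub (f g : L2) : fourierL2 (f - g) = fourierL2 f - fourierL2 g := by
  have h : (Complex.ofRealCLM.compLp (f - g) : Lp ℂ 2 (volume : Measure ℝ)) =
      Complex.ofRealCLM.compLp f - Complex.ofRealCLM.compLp g :=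
    map_sub (Complex.ofRealCLM.compLpₗ 2 (volume : Measure ℝ)) f g
  unfold fourierL2
  rw [h]
  exact map_sub (Lp.fourierTransformₗᵢ ℝ ℂ) _ _

theorem IsGlobalSolution.memSobolev (h : IsGlobalSolution γ₁ γ₂ δ₁ δ₂ (7 / 48) η₀ η) (t : ℝ) :
    MemSobolev (solHat η t) :=
  ⟨measurable_fourierL2 _, (h.mem_sobolev _ (le_max_right _ _)).memLp_bracket⟩

theorem sobolevNorm_solHat_sub (η : ℝ → L2) (t s : ℝ) :
    sobolevNorm (⇑(solHat η t) - ⇑(solHat η s)) =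
      (gevreyENorm 0 2 (η (max t 0) - η (max s 0))).toReal := by
  rw [← eLpNorm_bracket_eq, sobolevNorm, l2norm, fourierL2_sub]
  congr 1
  refine eLpNorm_congr_ae ?_
  filter_upwards [Lp.coeFn_sub (solHat η t) (solHat η s)] with ξ hξ
  rw [← hξ]
  rfl

theorem IsGlobalSolution.tendsto_sobolevNorm_sub
    (h : IsGlobalSolution γ₁ γ₂ δ₁ δ₂ (7 / 48) η₀ η) (s : ℝ) :
    Tendsto (fun t ↦ sobolevNorm (⇑(solHat η t) - ⇑(solHat η s))) (𝓝 s) (𝓝 0) := by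
  have h1 : Tendsto (fun t : ℝ ↦ max t 0) (𝓝 s) (𝓝[Ici 0] (max s 0)) :=
    tendsto_nhdsWithin_iff.2 ⟨(continuous_id.max continuous_const).tendsto s,
      Eventually.of_forall fun t ↦ mem_Ici.2 (le_max_right _ _)⟩
  have h2 := (ENNReal.tendsto_toReal ENNReal.zero_ne_top).comp
    ((h.continuous (max s 0) (le_max_right _ _)).comp h1)
  simpa only [sobolevNorm_solHat_sub] using! h2

theorem sobolevNorm_le_add {f g : ℝ → ℂ} (hf : MemSobolev f) (hg : MemSobolev g) :
    sobolevNorm f ≤ sobolevNorm g + sobolevNorm (f - g) := by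
  have hs := hf.sub hg
  unfold sobolevNorm l2norm
  rw [← ENNReal.toReal_add hg.memLp.2.ne hs.memLp.2.ne]
  refine ENNReal.toReal_mono (ENNReal.add_ne_top.2 ⟨hg.memLp.2.ne, hs.memLp.2.ne⟩) ?_
  refine le_trans (eLpNorm_mono_real fun ξ ↦ ?_) (eLpNorm_add_le hg.memLp.1 hs.memLp.1 one_le_two)
  rw [norm_mul, norm_norm, Real.norm_of_nonneg (by positivity)]
  simp only [Pi.add_apply, Pi.sub_apply]
  rw [← mul_add]
  gcongr
  calc ‖f ξ‖ = ‖g ξ + (f ξ - g ξ)‖ := by congr 1; ring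
    _ ≤ _ := norm_add_le _ _

theorem sobolevNorm_sub_comm (f g : ℝ → ℂ) : sobolevNorm (f - g) = sobolevNorm (g - f) := by
  unfold sobolevNorm
  congr 1
  ext ξ
  rw [Pi.sub_apply, Pi.sub_apply, norm_sub_rev]

theorem IsGlobalSolution.continuous_sobolevNorm
    (h : IsGlobalSolution γ₁ γ₂ δ₁ δ₂ (7 / 48) η₀ η) :
    Continuous fun t ↦ sobolevNorm (solHat η t) := by
  refine continuous_iff_continuousAt.2 fun s ↦ ?_
  rw [ContinuousAt, tendsto_iff_dist_tendsto_zero]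
  refine squeeze_zero (fun _ ↦ dist_nonneg) (fun t ↦ ?_) (h.tendsto_sobolevNorm_sub s)
  rw [Real.dist_eq, abs_sub_le_iff]
  have h1 := sobolevNorm_le_add (h.memSobolev t) (h.memSobolev s)
  have h2 := sobolevNorm_le_add (h.memSobolev s) (h.memSobolev t)
  rw [sobolevNorm_sub_comm] at h2
  constructor <;> linarith

theorem IsGlobalSolution.continuous_solHat
    (h : IsGlobalSolution γ₁ γ₂ δ₁ δ₂ (7 / 48) η₀ η) : Continuous (solHat η) := by
  refine continuous_iff_continuousAt.2 fun s ↦ ?_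
  rw [ContinuousAt, tendsto_iff_dist_tendsto_zero]
  refine squeeze_zero (fun _ ↦ dist_nonneg) (fun t ↦ ?_) (h.tendsto_sobolevNorm_sub s)
  rw [dist_eq_norm]
  refine le_trans (le_of_eq ?_) ((h.memSobolev t).sub (h.memSobolev s)).l2norm_le
  rw [Lp.norm_def, l2norm]
  congr 1
  exact eLpNorm_congr_ae (Lp.coeFn_sub _ _)

theorem conv_zero_left (g : ℝ → ℂ) : conv 0 g = 0 := by
  ext ξ; simp [conv]

theorem nonlinHat_zero : nonlinHat 0 = 0 := by
  have h : (fun s ↦ (freq s : ℂ) * (0 : ℝ → ℂ) s) = 0 := by ext s; simp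
  ext ξ
  simp only [nonlinHat, h, conv_zero_left]
  simp

theorem memSobolev_zero : MemSobolev 0 :=
  ⟨measurable_zero, by simp⟩

theorem sobolevNorm_zero : sobolevNorm 0 = 0 := by
  simp [sobolevNorm, l2norm]

theorem abs_freq_le_of_mem {R ξ : ℝ} (h : ξ ∈ Ioo (-R) R) : |freq ξ| ≤ freq R := by
  rw [freq, abs_mul, abs_of_pos (by positivity), freq]
  exact mul_le_mul_of_nonneg_left (abs_le.2 ⟨h.1.le, h.2.le⟩) (by positivity)

theorem freq_mul_le_of_mem {R ξ : ℝ} (h : ξ ∈ Ioo (-R) R) :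
    |freq ξ| * (1 + |freq ξ| ^ 2) ≤ freq R * (1 + freq R ^ 2) := by
  have h1 := abs_freq_le_of_mem h
  have h0 := abs_nonneg (freq ξ)
  have := h0.trans h1
  gcongr

theorem MemSobolev.memLp_cutoff_nonlinHat {f : ℝ → ℂ} (hf : MemSobolev f) (R : ℝ) :
    MemLp (indicator (Ioo (-R) R) (nonlinHat f)) 2 volume := by
  -- The Lipschitz bound is applied with zero as second argument, where the nonlinearity vanishes.
  refine memLp_cutoff_of_bound (measurable_nonlinHat hf.measurable)
    (K := freq R * (1 + freq R ^ 2) * (sobolevNorm (f - 0) * ((sobolevNorm f + 0) +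
      bracketConst * (sobolevNorm f * sobolevNorm f + 0 * (sobolevNorm f + 0)))))
    fun ξ hξ ↦ ?_
  · have := norm_nonlinHat_sub_le hf memSobolev_zero ξ rfl sobolevNorm_zero rfl
    rw [nonlinHat_zero, Pi.zero_apply, sub_zero] at this
    refine this.trans (mul_le_mul_of_nonneg_right (freq_mul_le_of_mem hξ) ?_)
    have h1 := sobolevNorm_nonneg f
    have h2 := sobolevNorm_nonneg (f - 0)
    have h3 := bracketConst_nonneg
    positivity

/-- The truncated nonlinearity along a solution. -/
def nonlinCutoff (h : IsGlobalSolution γ₁ γ₂ δ₁ δ₂ (7 / 48) η₀ η) (R t : ℝ) : L2C :=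
  ((h.memSobolev t).memLp_cutoff_nonlinHat R).toLp _

/-- On the band the Lipschitz bound is uniform in the frequency, so the L² distance is at most that
bound times the norm of the indicator of the band. -/
theorem continuous_nonlinCutoff (h : IsGlobalSolution γ₁ γ₂ δ₁ δ₂ (7 / 48) η₀ η) (R : ℝ) :
    Continuous (nonlinCutoff h R) := by
  refine continuous_iff_continuousAt.2 fun s ↦ ?_
  rw [ContinuousAt, tendsto_iff_dist_tendsto_zero]
  have hI : MemLp (indicator (Ioo (-R) R) fun _ ↦ (1 : ℂ)) 2 volume :=
    memLp_cutoff_of_bound measurable_const (K := 1) fun ξ _ ↦ by simp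
  set κ := freq R * (1 + freq R ^ 2) with hκ
  set A : ℝ → ℝ := fun t ↦ sobolevNorm (solHat η t) with hA
  set D : ℝ → ℝ := fun t ↦ sobolevNorm (⇑(solHat η t) - ⇑(solHat η s)) with hD
  have hAc : Continuous A := h.continuous_sobolevNorm
  have hDt : Tendsto D (𝓝 s) (𝓝 0) := h.tendsto_sobolevNorm_sub s
  set K : ℝ → ℝ := fun t ↦ |κ * (D t * ((A t + A s) +
    bracketConst * (A t * A t + A s * (A t + A s))))| with hK
  have hKt : Tendsto K (𝓝 s) (𝓝 0) := by
    have h1 : Tendsto (fun t ↦ (A t + A s) + bracketConst * (A t * A t + A s * (A t + A s)))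
      (𝓝 s) (𝓝 _) := Continuous.tendsto (by fun_prop) s
    have h2 := ((hDt.mul h1).const_mul κ).abs
    rw [zero_mul, mul_zero, abs_zero] at h2
    exact h2
  have hb (t : ℝ) : dist (nonlinCutoff h R t) (nonlinCutoff h R s) ≤ K t * ‖hI.toLp _‖ := by
    rw [dist_eq_norm]
    refine Lp.norm_le_mul_norm_of_ae_le_mul ?_
    filter_upwards [Lp.coeFn_sub (nonlinCutoff h R t) (nonlinCutoff h R s),
      ((h.memSobolev t).memLp_cutoff_nonlinHat R).coeFn_toLp,
      ((h.memSobolev s).memLp_cutoff_nonlinHat R).coeFn_toLp, hI.coeFn_toLp] with ξ h1 h2 h3 h4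
    rw [h1, h4, Pi.sub_apply, nonlinCutoff, nonlinCutoff, h2, h3]
    by_cases hξ : ξ ∈ Ioo (-R) R
    · simp only [indicator_of_mem hξ, norm_one, mul_one]
      refine (norm_nonlinHat_sub_le (h.memSobolev t) (h.memSobolev s) ξ rfl rfl rfl).trans ?_
      refine le_trans (mul_le_mul_of_nonneg_right (freq_mul_le_of_mem hξ) ?_) (le_abs_self _)
      have h1 := sobolevNorm_nonneg (solHat η t)
      have h2 := sobolevNorm_nonneg (solHat η s)
      have h3 := sobolevNorm_nonneg (⇑(solHat η t) - ⇑(solHat η s))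
      have h4 := bracketConst_nonneg
      positivity
    · simp [indicator_of_notMem hξ]
  refine squeeze_zero (fun _ ↦ dist_nonneg) hb ?_
  simpa using hKt.mul_const _

end Regularity

/-! ### Energy identity on a bounded frequency band -/

section EnergyIdentity

open scoped ComplexConjugate ContDiff

variable {γ₁ γ₂ δ₁ δ₂ : ℝ} {η₀ : L2} {η : ℝ → L2}

theorem continuous_energySymbol (γ₁ δ₁ : ℝ) :
    Continuous fun ξ ↦ ((energySymbol γ₁ δ₁ ξ : ℝ) : ℂ) := by
  unfold energySymbol; fun_prop

/-- The symbol of the linear part of the equation. -/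
def linSymbol (γ₂ δ₂ ξ : ℝ) : ℂ :=
  -Complex.I * ((freq ξ * (1 - γ₂ * freq ξ ^ 2 + δ₂ * freq ξ ^ 4) : ℝ) : ℂ)

theorem continuous_linSymbol (γ₂ δ₂ : ℝ) : Continuous (linSymbol γ₂ δ₂) := by
  unfold linSymbol; fun_prop

/-- The truncation of `(1 - γ₁ ∂ₓ² + δ₁ ∂ₓ⁴) η` on the Fourier side. -/
def momentum (γ₁ δ₁ : ℝ) (η : ℝ → L2) (R t : ℝ) : L2C :=
  cutoffMul (continuous_energySymbol γ₁ δ₁) R (solHat η t)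

/-- The truncated right-hand side of the equation on the Fourier side. -/
def momentumDeriv (h : IsGlobalSolution γ₁ γ₂ δ₁ δ₂ (7 / 48) η₀ η) (R t : ℝ) : L2C :=
  cutoffMul (continuous_linSymbol γ₂ δ₂) R (solHat η t) + nonlinCutoff h R t

theorem continuous_momentumDeriv (h : IsGlobalSolution γ₁ γ₂ δ₁ δ₂ (7 / 48) η₀ η) (R : ℝ) :
    Continuous (momentumDeriv h R) :=
  ((cutoffMul (continuous_linSymbol γ₂ δ₂) R).continuous.comp h.continuous_solHat).add
    (continuous_nonlinCutoff h R)

theorem momentumDeriv_coeFn (h : IsGlobalSolution γ₁ γ₂ δ₁ δ₂ (7 / 48) η₀ η) (R t : ℝ) :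
    ∀ᵐ ξ, momentumDeriv h R t ξ = indicator (Ioo (-R) R) (rhsHat γ₂ δ₂ (solHat η t)) ξ := by
  filter_upwards [Lp.coeFn_add (cutoffMul (continuous_linSymbol γ₂ δ₂) R (solHat η t))
    (nonlinCutoff h R t), cutoffMul_coeFn (continuous_linSymbol γ₂ δ₂) R (solHat η t),
    ((h.memSobolev t).memLp_cutoff_nonlinHat R).coeFn_toLp] with ξ h1 h2 h3
  rw [momentumDeriv, h1, Pi.add_apply, h2, nonlinCutoff, h3]
  by_cases hξ : ξ ∈ Ioo (-R) R
  · simp only [indicator_of_mem hξ, rhsHat, linSymbol]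
  · simp [indicator_of_notMem hξ]

/-- Each pairing with a test function satisfies a scalar differential equation with continuous
right-hand side, hence an integrated one. Pairings with test functions supported in the band
determine an L² function there, which yields the integrated equation in L². -/
theorem integral_momentumDeriv (h : IsGlobalSolution γ₁ γ₂ δ₁ δ₂ (7 / 48) η₀ η) (R : ℝ) {t : ℝ}
    (ht : 0 ≤ t) : ∀ᵐ ξ, ξ ∈ Ioo (-R) R →
      (momentum γ₁ δ₁ η R t - momentum γ₁ δ₁ η R 0 - ∫ s in (0 : ℝ)..t, momentumDeriv h R s) ξ
        = 0 := by
  refine isOpen_Ioo.ae_eq_zero_of_integral_contDiff_smul_eq_zero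
    (((Lp.memLp _).locallyIntegrable one_le_two).locallyIntegrableOn _) fun φ hφ hc hsupp ↦ ?_
  have hc' : HasCompactSupport (Complex.ofRealCLM ∘ φ) := hc.comp_left rfl
  have hφ' : ContDiff ℝ ∞ (Complex.ofRealCLM ∘ φ) := by fun_prop
  set χ : 𝓢(ℝ, ℂ) := hc'.toSchwartzMap hφ' with hχ
  have hv : ∀ x, χ x = (φ x : ℂ) := fun x ↦ rfl
  -- The test function vanishes off the band, so truncation is invisible to the pairing.
  have hout : ∀ ξ, ξ ∉ Ioo (-R) R → χ ξ = 0 := fun ξ hξ ↦ by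
    rw [hv, image_eq_zero_of_notMem_tsupport fun hh ↦ hξ (hsupp hh), Complex.ofReal_zero]
  have hU (τ : ℝ) : pairingCLM χ (momentum γ₁ δ₁ η R τ) =
      ∫ ξ, solHat η τ ξ * (energySymbol γ₁ δ₁ ξ * χ ξ) := by
    rw [pairingCLM_apply]
    refine integral_congr_ae ?_
    filter_upwards [cutoffMul_coeFn (continuous_energySymbol γ₁ δ₁) R (solHat η τ)] with ξ h1
    rw [momentum, h1]
    by_cases hξ : ξ ∈ Ioo (-R) R
    · rw [indicator_of_mem hξ]; ring
    · rw [hout ξ hξ]; ring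
  have hG (τ : ℝ) : pairingCLM χ (momentumDeriv h R τ) =
      ∫ ξ, rhsHat γ₂ δ₂ (solHat η τ) ξ * χ ξ := by
    rw [pairingCLM_apply]
    refine integral_congr_ae ?_
    filter_upwards [momentumDeriv_coeFn h R τ] with ξ h1
    rw [h1]
    by_cases hξ : ξ ∈ Ioo (-R) R
    · rw [indicator_of_mem hξ]
    · rw [hout ξ hξ]; ring
  have hGc : Continuous fun τ ↦ pairingCLM χ (momentumDeriv h R τ) :=
    (pairingCLM χ).continuous.comp (continuous_momentumDeriv h R)
  set S : ℝ → ℂ := fun τ ↦ ∫ ξ, fourierL2 (η τ) ξ * (energySymbol γ₁ δ₁ ξ * χ ξ) with hS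
  have hSU : ∀ τ, 0 ≤ τ → S τ = pairingCLM χ (momentum γ₁ δ₁ η R τ) := fun τ hτ ↦ by
    rw [hU, solHat, max_eq_left hτ]
  have hder : ∀ τ, 0 ≤ τ → HasDerivWithinAt S (pairingCLM χ (momentumDeriv h R τ)) (Ici 0) τ := by
    intro τ hτ
    rw [hG, solHat, max_eq_left hτ]
    exact h.hasDerivWithinAt_fourier χ hτ
  have hftc : ∫ s in (0 : ℝ)..t, pairingCLM χ (momentumDeriv h R s) = S t - S 0 := by
    refine intervalIntegral.integral_eq_sub_of_hasDeriv_right (fun τ hτ ↦ ?_) (fun τ hτ ↦ ?_)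
      (hGc.intervalIntegrable _ _)
    · rw [uIcc_of_le ht] at hτ
      exact (hder τ hτ.1).continuousWithinAt.mono fun y hy ↦ by
        rw [uIcc_of_le ht] at hy; exact hy.1
    · rw [min_eq_left ht] at hτ
      exact (hder τ hτ.1.le).mono fun y hy ↦ hτ.1.le.trans (le_of_lt hy)
  have hz : pairingCLM χ (momentum γ₁ δ₁ η R t - momentum γ₁ δ₁ η R 0 -
      ∫ s in (0 : ℝ)..t, momentumDeriv h R s) = 0 := by
    rw [map_sub, map_sub, ← hSU t ht, ← hSU 0 le_rfl,
      ← ContinuousLinearMap.intervalIntegral_comp_comm _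
        ((continuous_momentumDeriv h R).intervalIntegrable _ _), hftc, sub_self]
  rw [pairingCLM_apply] at hz
  rw [← hz]
  refine integral_congr_ae (ae_of_all _ fun ξ ↦ ?_)
  simp [hv, mul_comm]

theorem energySymbol_pos (hγ₁ : 0 < γ₁) (hδ₁ : 0 < δ₁) (ξ : ℝ) : 0 < energySymbol γ₁ δ₁ ξ := by
  unfold energySymbol; positivity

/-- The truncated energy identity. -/
theorem truncated_energy_identity (hγ₁ : 0 < γ₁) (hδ₁ : 0 < δ₁)
    (h : IsGlobalSolution γ₁ γ₂ δ₁ δ₂ (7 / 48) η₀ η) {w : ℝ → ℝ} (hw : Continuous w) (R : ℝ) :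
    Continuous (fun s ↦ ∫ ξ in Ioo (-R) R, (energyFlux (solHat η s) w ξ).re) ∧
    ∀ t, 0 ≤ t → ∫ ξ in Ioo (-R) R, energySymbol γ₁ δ₁ ξ * w ξ ^ 2 * ‖solHat η t ξ‖ ^ 2 =
      (∫ ξ in Ioo (-R) R, energySymbol γ₁ δ₁ ξ * w ξ ^ 2 * ‖solHat η 0 ξ‖ ^ 2) +
        ∫ s in (0 : ℝ)..t, 2 * ∫ ξ in Ioo (-R) R, (energyFlux (solHat η s) w ξ).re := by
  have hE := energySymbol_pos hγ₁ hδ₁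
  -- Dividing by the root of the energy symbol splits it evenly: the multiplier sends the momentum
  -- to w√E f, whose squared norm is the energy, and the factors 1/√E and √E cancel in the inner
  -- product with the derivative.
  have hm : Continuous fun ξ ↦ ((w ξ / √(energySymbol γ₁ δ₁ ξ) : ℝ) : ℂ) := by
    refine Complex.continuous_ofReal.comp (hw.div ?_ fun ξ ↦ (Real.sqrt_pos.2 (hE ξ)).ne')
    unfold energySymbol
    fun_prop
  set M := cutoffMul hm R with hM
  set Y : ℝ → L2C := fun t ↦ M (momentum γ₁ δ₁ η R t) with hY
  set Y' : ℝ → L2C := fun t ↦ M (momentumDeriv h R t) with hY'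
  have hY'c : Continuous Y' := M.continuous.comp (continuous_momentumDeriv h R)
  have hYc : Continuous Y := M.continuous.comp
    ((cutoffMul (continuous_energySymbol γ₁ δ₁) R).continuous.comp h.continuous_solHat)
  have hYv (t : ℝ) : ∀ᵐ ξ, Y t ξ = indicator (Ioo (-R) R)
      (fun ξ ↦ ((w ξ * √(energySymbol γ₁ δ₁ ξ) : ℝ) : ℂ) * solHat η t ξ) ξ := by
    filter_upwards [cutoffMul_coeFn hm R (momentum γ₁ δ₁ η R t),
      cutoffMul_coeFn (continuous_energySymbol γ₁ δ₁) R (solHat η t)] with ξ h1 h2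
    rw [hY, hM, h1, momentum, h2]
    by_cases hξ : ξ ∈ Ioo (-R) R
    · simp only [indicator_of_mem hξ]
      rw [← mul_assoc, ← Complex.ofReal_mul]
      congr 2
      have := (Real.sqrt_pos.2 (hE ξ)).ne'
      nth_rewrite 2 [← Real.mul_self_sqrt (hE ξ).le]
      field_simp
    · simp [indicator_of_notMem hξ]
  have hY'v (t : ℝ) : ∀ᵐ ξ, Y' t ξ = indicator (Ioo (-R) R)
      (fun ξ ↦ ((w ξ / √(energySymbol γ₁ δ₁ ξ) : ℝ) : ℂ) * rhsHat γ₂ δ₂ (solHat η t) ξ) ξ := by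
    filter_upwards [cutoffMul_coeFn hm R (momentumDeriv h R t),
      momentumDeriv_coeFn h R t] with ξ h1 h2
    rw [hY', hM, h1, h2]
    by_cases hξ : ξ ∈ Ioo (-R) R
    · simp only [indicator_of_mem hξ]
    · simp [indicator_of_notMem hξ]
  have hint (t : ℝ) (ht : 0 ≤ t) : Y t = Y 0 + ∫ s in (0 : ℝ)..t, Y' s := by
    have hz : M (momentum γ₁ δ₁ η R t - momentum γ₁ δ₁ η R 0 -
        ∫ s in (0 : ℝ)..t, momentumDeriv h R s) = 0 := by
      rw [Lp.eq_zero_iff_ae_eq_zero]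
      filter_upwards [cutoffMul_coeFn hm R (momentum γ₁ δ₁ η R t - momentum γ₁ δ₁ η R 0 -
        ∫ s in (0 : ℝ)..t, momentumDeriv h R s), integral_momentumDeriv h R ht] with ξ h1 h2
      rw [hM, h1, Pi.zero_apply]
      by_cases hξ : ξ ∈ Ioo (-R) R
      · rw [h2 hξ, mul_zero]
      · rw [indicator_of_notMem hξ, zero_mul]
    rw [map_sub, map_sub, ← ContinuousLinearMap.intervalIntegral_comp_comm _
        ((continuous_momentumDeriv h R).intervalIntegrable _ _)] at hz
    have := sub_eq_zero.1 hz
    rw [← this]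
    simp [hY]
  have hinner (s : ℝ) : inner ℝ (Y s) (Y' s) =
      ∫ ξ in Ioo (-R) R, (energyFlux (solHat η s) w ξ).re := by
    rw [L2.inner_def, ← integral_indicator measurableSet_Ioo]
    refine integral_congr_ae ?_
    filter_upwards [hYv s, hY'v s] with ξ h1 h2
    rw [h1, h2]
    by_cases hξ : ξ ∈ Ioo (-R) R
    · simp only [indicator_of_mem hξ]
      have hq := (Real.sqrt_pos.2 (hE ξ)).ne'
      rw [Complex.inner, energyFlux, rhsHat, map_mul, Complex.conj_ofReal]
      have e1 : ((w ξ * √(energySymbol γ₁ δ₁ ξ) : ℝ) : ℂ) *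
          ((w ξ / √(energySymbol γ₁ δ₁ ξ) : ℝ) : ℂ) = (w ξ : ℂ) ^ 2 := by
        rw [← Complex.ofReal_mul, ← Complex.ofReal_pow]
        congr 1
        field_simp
      set p := freq ξ * (1 - γ₂ * freq ξ ^ 2 + δ₂ * freq ξ ^ 4)
      set N := nonlinHat (solHat η s) ξ
      set z := solHat η s ξ
      -- The linear part is a real multiple of i and drops out on taking real parts.
      have e2 : ((w ξ / √(energySymbol γ₁ δ₁ ξ) : ℝ) : ℂ) * (-Complex.I * (p : ℂ) * z + N) *
          (((w ξ * √(energySymbol γ₁ δ₁ ξ) : ℝ) : ℂ) * conj z) =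
          ((-(w ξ ^ 2 * p * Complex.normSq z) : ℝ) : ℂ) * Complex.I +
            (w ξ : ℂ) ^ 2 * (conj z * N) := by
        push_cast
        rw [← e1, Complex.normSq_eq_conj_mul_self]
        push_cast
        ring
      rw [e2, Complex.add_re, Complex.re_ofReal_mul, Complex.I_re, mul_zero, zero_add]
    · simp [indicator_of_notMem hξ]
  have hnorm (t : ℝ) : ‖Y t‖ ^ 2 =
      ∫ ξ in Ioo (-R) R, energySymbol γ₁ δ₁ ξ * w ξ ^ 2 * ‖solHat η t ξ‖ ^ 2 := by
    rw [← real_inner_self_eq_norm_sq, L2.inner_def, ← integral_indicator measurableSet_Ioo]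
    refine integral_congr_ae ?_
    filter_upwards [hYv t] with ξ h1
    rw [h1]
    by_cases hξ : ξ ∈ Ioo (-R) R
    · simp only [indicator_of_mem hξ]
      rw [real_inner_self_eq_norm_sq, norm_mul, Complex.norm_real, mul_pow, Real.norm_eq_abs,
        sq_abs, mul_pow, Real.sq_sqrt (hE ξ).le]
      ring
    · simp [indicator_of_notMem hξ]
  have hcont : Continuous fun s ↦ inner ℝ (Y s) (Y' s) := hYc.inner hY'c
  simp_rw [← hinner, ← hnorm]
  refine ⟨hcont, fun t ht ↦ ?_⟩
  -- `Y` is known to equal this primitive only for nonnegative times, whereas `Z` is differentiable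
  -- on the whole line and so admits the two-sided calculus.
  set Z : ℝ → L2C := fun t ↦ Y 0 + ∫ s in (0 : ℝ)..t, Y' s with hZ
  have hZd (s : ℝ) : HasDerivAt Z (Y' s) s :=
    (intervalIntegral.integral_hasDerivAt_right (hY'c.intervalIntegrable _ _)
      (hY'c.stronglyMeasurableAtFilter _ _) hY'c.continuousAt).const_add _
  have hZc : Continuous Z := continuous_iff_continuousAt.2 fun s ↦ (hZd s).continuousAt
  have hftc := intervalIntegral.integral_eq_sub_of_hasDerivAt (a := 0) (b := t)
    (fun s _ ↦ (hZd s).norm_sq)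
    ((continuous_const.mul (hZc.inner hY'c)).intervalIntegrable _ _)
  have hcongr : ∫ s in (0 : ℝ)..t, 2 * inner ℝ (Y s) (Y' s) =
      ∫ s in (0 : ℝ)..t, 2 * inner ℝ (Z s) (Y' s) := by
    refine intervalIntegral.integral_congr fun s hs ↦ ?_
    rw [uIcc_of_le ht] at hs
    simp only [hZ]
    rw [← hint s hs.1]
  have h0 : Z 0 = Y 0 := by simp [hZ]
  rw [hcongr, hftc, hint t ht, h0]
  simp only [hZ]
  ring

end EnergyIdentity

/-! ### Weighted energy: comparison with the norm and growth identity -/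

section WeightedEnergy

open scoped ComplexConjugate

variable {γ₁ γ₂ δ₁ δ₂ : ℝ} {η₀ : L2} {η : ℝ → L2} {σ N : ℝ}

/-- The weighted Sobolev norm on the Fourier side. -/
def weightedNorm (σ N : ℝ) (f : ℝ → ℂ) : ℝ :=
  sobolevNorm fun ξ ↦ (expWeight σ N (freq ξ) : ℂ) * f ξ

/-- The weighted energy on the Fourier side. -/
def weightedEnergy (γ₁ δ₁ σ N : ℝ) (f : ℝ → ℂ) : ℝ :=
  ∫ ξ, energySymbol γ₁ δ₁ ξ * expWeight σ N (freq ξ) ^ 2 * ‖f ξ‖ ^ 2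

theorem norm_bracket_expWeight_mul_le (hσ : 0 ≤ σ) (f : ℝ → ℂ) (ξ : ℝ) :
    ‖bracket ξ ^ 2 * ‖(expWeight σ N (freq ξ) : ℂ) * f ξ‖‖ ≤
      Real.exp (σ * N) * ‖bracket ξ ^ 2 * ‖f ξ‖‖ := by
  rw [norm_mul, norm_norm, norm_mul, norm_mul, norm_norm, Complex.norm_real, Real.norm_eq_abs (expWeight _ _ _),
    abs_of_pos (expWeight_pos _ _ _)]
  calc _ = expWeight σ N (freq ξ) * (‖bracket ξ ^ 2‖ * ‖f ξ‖) := by ring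
    _ ≤ _ := by gcongr; exact expWeight_le hσ _

theorem MemSobolev.expWeight_mul {f : ℝ → ℂ} (hf : MemSobolev f) (hσ : 0 ≤ σ) (N : ℝ) :
    MemSobolev fun ξ ↦ (expWeight σ N (freq ξ) : ℂ) * f ξ := by
  have hfm := hf.measurable
  have hw := expWeight_freq_measurable σ N
  have hm : Measurable fun ξ ↦ (expWeight σ N (freq ξ) : ℂ) * f ξ := by fun_prop
  exact ⟨hm, hf.memLp.of_le_mul (Measurable.aestronglyMeasurable (by fun_prop))
    (ae_of_all _ (norm_bracket_expWeight_mul_le hσ f))⟩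

/-- The constant grows exponentially in `N`. It enters only the dominated convergence argument for
fixed `N`, never the final bound. -/
theorem MemSobolev.weightedNorm_le {f : ℝ → ℂ} (hf : MemSobolev f) (hσ : 0 ≤ σ) (N : ℝ) :
    weightedNorm σ N f ≤ Real.exp (σ * N) * sobolevNorm f := by
  have h := eLpNorm_le_mul_eLpNorm_of_ae_le_mul
    (ae_of_all volume (norm_bracket_expWeight_mul_le (N := N) hσ f)) 2
  have h' := ENNReal.toReal_mono (ENNReal.mul_ne_top ENNReal.ofReal_ne_top hf.memLp.2.ne) h
  rwa [ENNReal.toReal_mul, ENNReal.toReal_ofReal (Real.exp_pos _).le] at h'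

theorem MemSobolev.integrable_sq {f : ℝ → ℂ} (hf : MemSobolev f) :
    Integrable (fun ξ ↦ bracket ξ ^ 4 * ‖f ξ‖ ^ 2) volume := by
  refine hf.memLp.integrable_sq.congr (ae_of_all _ fun ξ ↦ ?_)
  simp only
  ring

theorem MemSobolev.sobolevNorm_sq {f : ℝ → ℂ} (hf : MemSobolev f) :
    sobolevNorm f ^ 2 = ∫ ξ, bracket ξ ^ 4 * ‖f ξ‖ ^ 2 := by
  have h0 : 0 ≤ ∫ ξ, bracket ξ ^ 4 * ‖f ξ‖ ^ 2 :=
    integral_nonneg fun ξ ↦ by have := bracket_pos ξ; positivity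
  have h : ∫ ξ, ‖bracket ξ ^ 2 * ‖f ξ‖‖ ^ (2 : ℝ≥0∞).toReal = ∫ ξ, bracket ξ ^ 4 * ‖f ξ‖ ^ 2 := by
    refine integral_congr_ae (ae_of_all _ fun ξ ↦ ?_)
    simp only [ENNReal.toReal_ofNat, Real.rpow_ofNat, Real.norm_eq_abs, sq_abs]
    ring
  rw [sobolevNorm, l2norm, hf.memLp.eLpNorm_eq_integral_rpow_norm two_ne_zero (by simp), h,
    ENNReal.toReal_ofReal (by positivity), ENNReal.toReal_ofNat, ← Real.rpow_natCast,
    ← Real.rpow_mul h0]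
  norm_num

/-- From (x² - 1)² ≥ 0 one has (1 + x²)² ≤ 2(1 + x⁴); the γ₁ term is discarded. -/
theorem energySymbol_ge (hγ₁ : 0 < γ₁) (hδ₁ : 0 < δ₁) (ξ : ℝ) :
    min 1 δ₁ / 2 * bracket ξ ^ 4 ≤ energySymbol γ₁ δ₁ ξ := by
  have h : bracket ξ ^ 4 = (1 + freq ξ ^ 2) ^ 2 := by rw [← bracket_sq]; ring
  rw [h, energySymbol]
  set x := freq ξ
  have h1 : min 1 δ₁ * 1 ≤ 1 := by linarith [min_le_left 1 δ₁]
  have h2 : min 1 δ₁ * x ^ 4 ≤ δ₁ * x ^ 4 := by gcongr; exact min_le_right _ _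
  have h3 : 0 ≤ γ₁ * x ^ 2 := by positivity
  have h0 : 0 ≤ min 1 δ₁ := (lt_min one_pos hδ₁).le
  nlinarith [mul_nonneg h0 (sq_nonneg (x ^ 2 - 1))]

theorem energySymbol_le (hγ₁ : 0 < γ₁) (hδ₁ : 0 < δ₁) (ξ : ℝ) :
    energySymbol γ₁ δ₁ ξ ≤ (1 + γ₁ + δ₁) * bracket ξ ^ 4 := by
  have h : bracket ξ ^ 4 = (1 + freq ξ ^ 2) ^ 2 := by rw [← bracket_sq]; ring
  rw [h, energySymbol]
  set x := freq ξ
  have : 0 ≤ x ^ 2 := sq_nonneg x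
  have : 0 ≤ x ^ 4 := by positivity
  have h1 : 1 ≤ (1 + x ^ 2) ^ 2 := by nlinarith
  have h2 : γ₁ * x ^ 2 ≤ γ₁ * (1 + x ^ 2) ^ 2 :=
    mul_le_mul_of_nonneg_left (by nlinarith) hγ₁.le
  have h3 : δ₁ * x ^ 4 ≤ δ₁ * (1 + x ^ 2) ^ 2 :=
    mul_le_mul_of_nonneg_left (by nlinarith) hδ₁.le
  linarith

theorem MemSobolev.integrable_energy {f : ℝ → ℂ} (hf : MemSobolev f) (hγ₁ : 0 < γ₁) (hδ₁ : 0 < δ₁)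
    (hσ : 0 ≤ σ) (N : ℝ) : Integrable
      (fun ξ ↦ energySymbol γ₁ δ₁ ξ * expWeight σ N (freq ξ) ^ 2 * ‖f ξ‖ ^ 2) volume := by
  have hfm := hf.measurable
  have hw := expWeight_freq_measurable σ N
  have hq : Measurable (energySymbol γ₁ δ₁) := by
    have : Continuous (energySymbol γ₁ δ₁) := by unfold energySymbol; fun_prop
    exact this.measurable
  refine ((hf.expWeight_mul hσ N).integrable_sq.const_mul (1 + γ₁ + δ₁)).mono'
    (Measurable.aestronglyMeasurable (by fun_prop)) (ae_of_all _ fun ξ ↦ ?_)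
  have h0 := energySymbol_pos hγ₁ hδ₁ ξ
  rw [Real.norm_eq_abs, abs_of_nonneg (by positivity), norm_mul, Complex.norm_real,
    Real.norm_eq_abs, mul_pow, sq_abs, ← mul_assoc, ← mul_assoc]
  gcongr
  exact energySymbol_le hγ₁ hδ₁ ξ

theorem MemSobolev.weightedNorm_sq_le {f : ℝ → ℂ} (hf : MemSobolev f) (hγ₁ : 0 < γ₁)
    (hδ₁ : 0 < δ₁) (hσ : 0 ≤ σ) (N : ℝ) :
    min 1 δ₁ / 2 * weightedNorm σ N f ^ 2 ≤ weightedEnergy γ₁ δ₁ σ N f := by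
  have hg := hf.expWeight_mul hσ N
  rw [weightedNorm, hg.sobolevNorm_sq, ← integral_const_mul]
  refine integral_mono (hg.integrable_sq.const_mul _) (hf.integrable_energy hγ₁ hδ₁ hσ N)
    fun ξ ↦ ?_
  simp only
  rw [norm_mul, Complex.norm_real, Real.norm_eq_abs, mul_pow, sq_abs, ← mul_assoc, ← mul_assoc]
  gcongr
  exact energySymbol_ge hγ₁ hδ₁ ξ

theorem MemSobolev.weightedEnergy_le {f : ℝ → ℂ} (hf : MemSobolev f) (hγ₁ : 0 < γ₁)
    (hδ₁ : 0 < δ₁) (hσ : 0 ≤ σ) (N : ℝ) :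
    weightedEnergy γ₁ δ₁ σ N f ≤ (1 + γ₁ + δ₁) * weightedNorm σ N f ^ 2 := by
  have hg := hf.expWeight_mul hσ N
  rw [weightedNorm, hg.sobolevNorm_sq, ← integral_const_mul]
  refine integral_mono (hf.integrable_energy hγ₁ hδ₁ hσ N) (hg.integrable_sq.const_mul _)
    fun ξ ↦ ?_
  simp only
  rw [norm_mul, Complex.norm_real, Real.norm_eq_abs, mul_pow, sq_abs, ← mul_assoc, ← mul_assoc]
  gcongr
  exact energySymbol_le hγ₁ hδ₁ ξ

/-- The polynomial controlling the growth of the weighted energy. -/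
def growthBound (n : ℝ) : ℝ := 24 * (bracketConst * n ^ 3) + 3 / 8 * (bracketConst ^ 2 * n ^ 4)

theorem growthBound_nonneg {n : ℝ} (hn : 0 ≤ n) : 0 ≤ growthBound n := by
  have := bracketConst_nonneg
  unfold growthBound; positivity

theorem growthBound_mono {m n : ℝ} (hm : 0 ≤ m) (h : m ≤ n) : growthBound m ≤ growthBound n := by
  have := bracketConst_nonneg
  unfold growthBound; gcongr

/-- The time derivative of the weighted energy. -/
def energyRate (σ N : ℝ) (η : ℝ → L2) (s : ℝ) : ℝ :=
  2 * ∫ ξ, (energyFlux (solHat η s) (fun ξ ↦ expWeight σ N (freq ξ)) ξ).re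

theorem IsGlobalSolution.energyFlux_solHat (h : IsGlobalSolution γ₁ γ₂ δ₁ δ₂ (7 / 48) η₀ η)
    (hσ : 0 ≤ σ) (hN : 0 ≤ N) (s : ℝ) :
    Integrable (energyFlux (solHat η s) fun ξ ↦ expWeight σ N (freq ξ)) volume ∧
    ∫ ξ, ‖energyFlux (solHat η s) (fun ξ ↦ expWeight σ N (freq ξ)) ξ‖ ≤
      6 * (bracketConst * weightedNorm σ N (solHat η s) ^ 3) +
        1 / 8 * (bracketConst ^ 2 * weightedNorm σ N (solHat η s) ^ 4) ∧
    ‖∫ ξ, energyFlux (solHat η s) (fun ξ ↦ expWeight σ N (freq ξ)) ξ‖ ≤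
      σ * growthBound (weightedNorm σ N (solHat η s)) :=
  energyFlux_estimate hσ hN (h.memSobolev s).measurable (h.memSobolev s).memLp
    (fourierL2_neg _) rfl

theorem IsGlobalSolution.energyRate_le (h : IsGlobalSolution γ₁ γ₂ δ₁ δ₂ (7 / 48) η₀ η)
    (hσ : 0 ≤ σ) (hN : 0 ≤ N) (s : ℝ) :
    energyRate σ N η s ≤ 2 * (σ * growthBound (weightedNorm σ N (solHat η s))) := by
  obtain ⟨hi, -, hb⟩ := h.energyFlux_solHat hσ hN s
  unfold energyRate
  gcongr
  have := Complex.reCLM.integral_comp_comm hi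
  simp only [Complex.reCLM_apply] at this
  rw [this]
  exact (Complex.re_le_norm _).trans hb

/-- The energy identity for the weighted energy. -/
theorem IsGlobalSolution.weightedEnergy_eq (hγ₁ : 0 < γ₁) (hδ₁ : 0 < δ₁)
    (h : IsGlobalSolution γ₁ γ₂ δ₁ δ₂ (7 / 48) η₀ η) (hσ : 0 ≤ σ) (hN : 0 ≤ N) {t : ℝ}
    (ht : 0 ≤ t) :
    IntervalIntegrable (energyRate σ N η) volume 0 t ∧
    weightedEnergy γ₁ δ₁ σ N (solHat η t) = weightedEnergy γ₁ δ₁ σ N (solHat η 0) +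
      ∫ s in (0 : ℝ)..t, energyRate σ N η s := by
  set w : ℝ → ℝ := fun ξ ↦ expWeight σ N (freq ξ) with hw_def
  have hw : Continuous w := by
    have := continuous_expWeight σ N
    unfold w freq
    fun_prop
  have hR := tendsto_natCast_atTop_atTop (R := ℝ)
  have hcov : AECover volume atTop fun n : ℕ ↦ Ioo (-(n : ℝ)) n :=
    aecover_Ioo (tendsto_neg_atTop_atBot.comp hR) hR
  have hE (t : ℝ) : Tendsto (fun n : ℕ ↦ ∫ ξ in Ioo (-(n : ℝ)) n,
      energySymbol γ₁ δ₁ ξ * w ξ ^ 2 * ‖solHat η t ξ‖ ^ 2) atTop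
      (𝓝 (weightedEnergy γ₁ δ₁ σ N (solHat η t))) :=
    hcov.integral_tendsto_of_countably_generated
      ((h.memSobolev t).integrable_energy hγ₁ hδ₁ hσ N)
  set F : ℕ → ℝ → ℝ := fun n s ↦
    2 * ∫ ξ in Ioo (-(n : ℝ)) n, (energyFlux (solHat η s) w ξ).re with hF
  have hFc (n : ℕ) : Continuous (F n) :=
    continuous_const.mul (truncated_energy_identity hγ₁ hδ₁ h hw n).1
  have hFt (s : ℝ) : Tendsto (fun n ↦ F n s) atTop (𝓝 (energyRate σ N η s)) :=
    (hcov.integral_tendsto_of_countably_generated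
      (h.energyFlux_solHat hσ hN s).1.re).const_mul 2
  obtain ⟨C, hC⟩ := isCompact_Icc.exists_bound_of_continuousOn (s := Icc 0 t)
    h.continuous_sobolevNorm.continuousOn
  set n₀ := Real.exp (σ * N) * C
  -- Restricting to a band spoils the cancellation, so the bound without the factor `σ` is used. It
  -- is uniform in `n` and in the times of [0, t].
  have hbound (n : ℕ) (s : ℝ) (hs : s ∈ Icc 0 t) : ‖F n s‖ ≤
      2 * (6 * (bracketConst * n₀ ^ 3) + 1 / 8 * (bracketConst ^ 2 * n₀ ^ 4)) := by
    obtain ⟨hi, hb, -⟩ := h.energyFlux_solHat hσ hN s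
    have hn : weightedNorm σ N (solHat η s) ≤ n₀ :=
      ((h.memSobolev s).weightedNorm_le hσ N).trans
        (mul_le_mul_of_nonneg_left ((Real.le_norm_self _).trans (hC s hs)) (Real.exp_pos _).le)
    have h0 : 0 ≤ weightedNorm σ N (solHat η s) := sobolevNorm_nonneg _
    have hbc := bracketConst_nonneg
    rw [hF, norm_mul, Real.norm_ofNat]
    gcongr
    calc _ ≤ ∫ ξ in Ioo (-(n : ℝ)) n, ‖(energyFlux (solHat η s) w ξ).re‖ :=
          norm_integral_le_integral_norm _
      _ ≤ ∫ ξ in Ioo (-(n : ℝ)) n, ‖energyFlux (solHat η s) w ξ‖ :=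
          integral_mono hi.re.norm.integrableOn hi.norm.integrableOn
            fun ξ ↦ Complex.abs_re_le_norm _
      _ ≤ ∫ ξ, ‖energyFlux (solHat η s) w ξ‖ :=
          setIntegral_le_integral hi.norm (ae_of_all _ fun ξ ↦ norm_nonneg _)
      _ ≤ _ := hb
      _ ≤ _ := by gcongr
  have hsub : uIoc 0 t ⊆ Icc 0 t := by rw [uIoc_of_le ht]; exact Ioc_subset_Icc_self
  have hmeas : StronglyMeasurable (energyRate σ N η) :=
    stronglyMeasurable_of_tendsto atTop (fun n ↦ (hFc n).stronglyMeasurable)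
      (tendsto_pi_nhds.2 hFt)
  refine ⟨(intervalIntegrable_const (c :=
      2 * (6 * (bracketConst * n₀ ^ 3) + 1 / 8 * (bracketConst ^ 2 * n₀ ^ 4)))).mono_fun'
    hmeas.aestronglyMeasurable ((ae_restrict_iff' measurableSet_uIoc).2
      (ae_of_all _ fun s hs ↦ le_of_tendsto (hFt s).norm
        (Eventually.of_forall fun n ↦ hbound n s (hsub hs)))), ?_⟩
  have hint : Tendsto (fun n ↦ ∫ s in (0 : ℝ)..t, F n s) atTop
      (𝓝 (∫ s in (0 : ℝ)..t, energyRate σ N η s)) :=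
    intervalIntegral.tendsto_integral_filter_of_dominated_convergence
      (fun _ ↦ 2 * (6 * (bracketConst * n₀ ^ 3) + 1 / 8 * (bracketConst ^ 2 * n₀ ^ 4)))
      (Eventually.of_forall fun n ↦ (hFc n).aestronglyMeasurable)
      (Eventually.of_forall fun n ↦ ae_of_all _ fun s hs ↦ hbound n s (hsub hs))
      intervalIntegrable_const (ae_of_all _ fun s _ ↦ hFt s)
  refine tendsto_nhds_unique (hE t) (((hE 0).add hint).congr fun n ↦ ?_)
  exact ((truncated_energy_identity hγ₁ hδ₁ h hw n).2 t ht).symm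

end WeightedEnergy

/-! ### Continuity argument -/

section Bootstrap

/-- A continuity argument: if the growth of `E` is controlled as long as `E ≤ 2 M`, then `E ≤ 2 M`
persists for a time inversely proportional to the growth rate. -/
theorem le_two_mul_of_growth {E F : ℝ → ℝ} {T M L : ℝ} (hL : 0 ≤ L)
    (hF : ∀ t ∈ Icc 0 T, IntervalIntegrable F volume 0 t)
    (hE : ∀ t ∈ Icc 0 T, E t = E 0 + ∫ s in (0 : ℝ)..t, F s) (h0 : E 0 ≤ M)
    (hb : ∀ t ∈ Icc 0 T, E t ≤ 2 * M → F t ≤ L) (hLT : L * T < M) :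
    ∀ t ∈ Icc 0 T, E t ≤ 2 * M := by
  intro t ht
  by_contra! hlt
  have hcont : ContinuousOn E (Icc 0 t) := by
    have hp := intervalIntegral.continuousOn_primitive_interval'
      (hF t ht) left_mem_uIcc
    rw [uIcc_of_le ht.1] at hp
    exact (continuousOn_const.add hp).congr fun s hs ↦ hE s ⟨hs.1, hs.2.trans ht.2⟩
  have hcpt : IsCompact (Icc 0 t ∩ E ⁻¹' Ici (2 * M)) :=
    isCompact_Icc.of_isClosed_subset (hcont.preimage_isClosed_of_isClosed isClosed_Icc isClosed_Ici)
      inter_subset_left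
  -- τ is the first time at which E ≥ 2M. Before τ the rate is at most L, so E(τ) ≤ M + LT < 2M, a
  -- contradiction.
  obtain ⟨τ, ⟨hτ, hτE⟩, hmin⟩ := hcpt.exists_isLeast ⟨t, ⟨ht.1, le_rfl⟩, hlt.le⟩
  have hτT : τ ∈ Icc 0 T := ⟨hτ.1, hτ.2.trans ht.2⟩
  have hle : ∫ s in (0 : ℝ)..τ, F s ≤ ∫ _ in (0 : ℝ)..τ, L := by
    refine intervalIntegral.integral_mono_on_of_le_Ioo hτ.1 (hF τ hτT) intervalIntegrable_const
      fun s hs ↦ hb s ⟨hs.1.le, hs.2.le.trans hτT.2⟩ ?_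
    by_contra! hs'
    exact hs.2.not_ge (hmin ⟨⟨hs.1.le, hs.2.le.trans hτ.2⟩, hs'.le⟩)
  rw [intervalIntegral.integral_const, sub_zero, smul_eq_mul] at hle
  have h1 : 2 * M ≤ E τ := hτE
  have h2 : τ * L ≤ L * T := by
    rw [mul_comm]
    exact mul_le_mul_of_nonneg_left hτT.2 hL
  linarith [hE τ hτT]

end Bootstrap

/-! ### Removing the truncation and choosing the radius -/

section Conclusion

variable {γ₁ γ₂ δ₁ δ₂ : ℝ} {η₀ : L2} {η : ℝ → L2} {σ σ₀ : ℝ}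

theorem tendsto_expWeight (σ x : ℝ) :
    Tendsto (fun n : ℕ ↦ expWeight σ n x) atTop (𝓝 (Real.exp (σ * |x|))) := by
  refine tendsto_const_nhds.congr' ?_
  filter_upwards [tendsto_natCast_atTop_atTop.eventually_ge_atTop |x|] with n hn
  rw [expWeight, min_eq_left hn]

/-- Fatou's lemma: the truncated weights converge pointwise to the exponential weight and the bound
`C` does not depend on the truncation. -/
theorem memGevrey_of_weightedNorm_le {ζ : L2} {C : ℝ} (hσ : 0 ≤ σ)
    (hf : MemSobolev (fourierL2 ζ)) (hC : ∀ n : ℕ, weightedNorm σ n (fourierL2 ζ) ≤ C) :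
    MemGevrey σ 2 ζ := by
  have hg (n : ℕ) := hf.expWeight_mul hσ n
  have hle := Lp.eLpNorm_lim_le_liminf_eLpNorm (p := 2) (μ := volume)
    (fun n ↦ (hg n).memLp.1)
    (fun ξ ↦ bracket ξ ^ 2 * ‖(Real.exp (σ * |freq ξ|) : ℂ) * fourierL2 ζ ξ‖)
    (ae_of_all _ fun ξ ↦ (((Complex.continuous_ofReal.tendsto _).comp
      (tendsto_expWeight σ (freq ξ))).mul_const _).norm.const_mul _)
  have hb (n : ℕ) : eLpNorm (fun ξ ↦ bracket ξ ^ 2 *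
      ‖(expWeight σ n (freq ξ) : ℂ) * fourierL2 ζ ξ‖) 2 volume ≤ ENNReal.ofReal C :=
    ENNReal.le_ofReal_iff_toReal_le (hg n).memLp.2.ne ((sobolevNorm_nonneg _).trans (hC 0)) |>.2
      (hC n)
  rw [MemGevrey, gevreyENorm_two]
  refine lt_of_le_of_lt ?_ (ENNReal.ofReal_lt_top (r := C))
  calc _ = _ := eLpNorm_congr_norm_ae (ae_of_all _ fun ξ ↦ ?_)
    _ ≤ _ := hle
    _ ≤ ENNReal.ofReal C :=
      liminf_le_of_le (by isBoundedDefault) fun b hb' ↦ by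
        obtain ⟨n, hn⟩ := hb'.exists
        exact hn.trans (hb n)
  have := pow_pos (bracket_pos ξ) 2
  simp only [norm_mul, Complex.norm_real, norm_norm]
  ring

theorem weightedNorm_le_gevreyNorm {ζ : L2} (hζ : MemGevrey σ₀ 2 ζ) (hσ : 0 ≤ σ) (hle : σ ≤ σ₀)
    (N : ℝ) : weightedNorm σ N (fourierL2 ζ) ≤ gevreyNorm σ₀ 2 ζ := by
  rw [MemGevrey, gevreyENorm_two] at hζ
  rw [gevreyNorm, gevreyENorm_two]
  refine ENNReal.toReal_mono hζ.ne (eLpNorm_mono fun ξ ↦ ?_)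
  have h1 : expWeight σ N (freq ξ) ≤ Real.exp (σ₀ * |freq ξ|) := by
    refine Real.exp_le_exp.2 ((mul_le_mul_of_nonneg_left (min_le_left _ _) hσ).trans ?_)
    gcongr
  rw [norm_mul, norm_norm, norm_mul, norm_mul, Complex.norm_real, Complex.norm_real, norm_mul,
    Real.norm_eq_abs (expWeight _ _ _), abs_of_pos (expWeight_pos _ _ _),
    Real.norm_eq_abs (Real.exp _), abs_of_pos (Real.exp_pos _)]
  rw [← mul_assoc, mul_comm ‖bracket ξ ^ 2‖]
  gcongr

/-- The square root is the norm bound implied by an energy of at most `2 * M`, and `hσT` is the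
bootstrap condition that rate times duration stay below `M`. Neither involves the truncation level,
so the conclusion survives its removal. -/
theorem IsGlobalSolution.memGevrey (hγ₁ : 0 < γ₁) (hδ₁ : 0 < δ₁)
    (h : IsGlobalSolution γ₁ γ₂ δ₁ δ₂ (7 / 48) η₀ η) (hη₀ : MemGevrey σ₀ 2 η₀) (hσ : 0 ≤ σ)
    (hle : σ ≤ σ₀) {M T : ℝ} (hT : 0 ≤ T) (hM : (1 + γ₁ + δ₁) * gevreyNorm σ₀ 2 η₀ ^ 2 ≤ M)
    (hσT : 2 * (σ * growthBound √(2 * M / (min 1 δ₁ / 2))) * T < M) : MemGevrey σ 2 (η T) := by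
  have hc : 0 < min 1 δ₁ / 2 := half_pos (lt_min one_pos hδ₁)
  have hn (n : ℕ) {t : ℝ} (ht : weightedEnergy γ₁ δ₁ σ n (solHat η t) ≤ 2 * M) :
      weightedNorm σ n (solHat η t) ≤ √(2 * M / (min 1 δ₁ / 2)) := by
    refine Real.le_sqrt_of_sq_le ?_
    rw [le_div_iff₀ hc, mul_comm]
    exact ((h.memSobolev t).weightedNorm_sq_le hγ₁ hδ₁ hσ n).trans ht
  have hE (n : ℕ) : weightedEnergy γ₁ δ₁ σ n (solHat η T) ≤ 2 * M := by
    refine le_two_mul_of_growth (E := fun t ↦ weightedEnergy γ₁ δ₁ σ n (solHat η t))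
      (F := energyRate σ n η) (T := T)
      (by have := growthBound_nonneg (Real.sqrt_nonneg (2 * M / (min 1 δ₁ / 2))); positivity)
      (fun t ht ↦ (h.weightedEnergy_eq hγ₁ hδ₁ hσ n.cast_nonneg ht.1).1)
      (fun t ht ↦ (h.weightedEnergy_eq hγ₁ hδ₁ hσ n.cast_nonneg ht.1).2) ?_ (fun t _ hle ↦ ?_)
      hσT T ⟨hT, le_rfl⟩
    · refine ((h.memSobolev 0).weightedEnergy_le hγ₁ hδ₁ hσ n).trans (le_trans ?_ hM)
      have h0 : 0 ≤ weightedNorm σ n (solHat η 0) := sobolevNorm_nonneg _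
      gcongr
      rw [solHat, max_self, h.initial]
      exact weightedNorm_le_gevreyNorm hη₀ hσ hle n
    · refine (h.energyRate_le hσ n.cast_nonneg t).trans ?_
      gcongr
      exact growthBound_mono (sobolevNorm_nonneg _) (hn n hle)
  have hs : solHat η T = fourierL2 (η T) := by rw [solHat, max_eq_left hT]
  refine memGevrey_of_weightedNorm_le (C := √(2 * M / (min 1 δ₁ / 2))) hσ (hs ▸ h.memSobolev T) fun n ↦ ?_
  rw [← hs]
  exact hn n (hE n)

end Conclusion

end KdVBBM

end

/-! ### The main theorem -/

theorem theorem1 (γ₁ γ₂ δ₁ δ₂ γ : ℝ) (hγ₁ : 0 < γ₁) (hδ₁ : 0 < δ₁) (hγ : γ = 7 / 48) :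
    ∃ c : ℝ → ℝ, (∀ r : ℝ, 0 < c r) ∧
      ∀ (σ₀ : ℝ) (η₀ : KdVBBM.L2) (η : ℝ → KdVBBM.L2), 0 < σ₀ →
        KdVBBM.MemGevrey σ₀ 2 η₀ →
        KdVBBM.IsGlobalSolution γ₁ γ₂ δ₁ δ₂ γ η₀ η →
        ∃ σ : ℝ → ℝ,
          (∀ t : ℝ, 0 < t → 0 < σ t ∧ KdVBBM.MemGevrey (σ t) 2 (η t)) ∧
          ∀ᶠ t in Filter.atTop, c (KdVBBM.gevreyNorm σ₀ 2 η₀) / t ≤ σ t := by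
  subst hγ
  -- The summand 1 keeps `M` positive even for zero datum.
  set M : ℝ → ℝ := fun r ↦ (1 + γ₁ + δ₁) * r ^ 2 + 1
  set K : ℝ → ℝ := fun r ↦ KdVBBM.growthBound √(2 * M r / (min 1 δ₁ / 2))
  have hM (r : ℝ) : 0 < M r := by positivity
  have hK (r : ℝ) : 0 ≤ K r := KdVBBM.growthBound_nonneg (Real.sqrt_nonneg _)
  have hden (r : ℝ) : 0 < 2 * K r + 1 := by linarith [hK r]
  -- Adding 1 to the denominator makes it positive and the bootstrap inequality strict.
  refine ⟨fun r ↦ M r / (2 * K r + 1), fun r ↦ div_pos (hM r) (hden r),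
    fun σ₀ η₀ η hσ₀ hη₀ h ↦ ?_⟩
  set r := KdVBBM.gevreyNorm σ₀ 2 η₀
  set c := M r / (2 * K r + 1) with hc
  have hcpos : 0 < c := div_pos (hM r) (hden r)
  -- For each final time t the argument is run on [0, t] with one fixed radius. It may not exceed
  -- `σ₀`, the radius of the datum; once t ≥ c/σ₀ the minimum is c/t itself.
  refine ⟨fun t ↦ min σ₀ (c / t), fun t ht ↦ ?_, ?_⟩
  · have hpos : 0 < min σ₀ (c / t) := lt_min hσ₀ (div_pos hcpos ht)
    refine ⟨hpos, h.memGevrey hγ₁ hδ₁ hη₀ hpos.le (min_le_left _ _) ht.le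
      (M := M r) (by simp only [M]; linarith) ?_⟩
    have h1 : min σ₀ (c / t) * t ≤ c := by
      rw [← le_div_iff₀ ht]; exact min_le_right _ _
    have h2 : c * (2 * K r + 1) = M r := div_mul_cancel₀ _ (hden r).ne'
    calc _ = min σ₀ (c / t) * t * (2 * K r) := by simp only [K]; ring
      _ ≤ c * (2 * K r) := mul_le_mul_of_nonneg_right h1 (by linarith [hK r])
      _ < M r := by linarith
  · filter_upwards [Filter.eventually_ge_atTop (c / σ₀), Filter.eventually_gt_atTop 0] with t h1 h2
    refine le_min ?_ le_rfl
    rw [div_le_iff₀ h2]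
    rwa [div_le_iff₀ hσ₀, mul_comm] at h1
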